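/- Let $\mathcal Q$ be a finite abelian group (written additively) of order $q\ge 2$, and let $r,n\ge 1$. A vector $x\in\mathcal Q^{r,n}$ consists of $n$ blocks of length $r$ over $\mathcal Q$. Its shape is $e=(e_1,\dots,e_r)$, where $e_i$ is the number of blocks of $x$ whose rightmost nonzero entry is in position $i$. Put $\Delta_{r,n}=\{e\in\mathbb Z_{\ge0}^r:\sum_i e_i\le n\}$, $|e|=\sum_i e_i$ and $|e|'=\sum_i i\,e_i$. The ordered distance between $x$ and $y$ is $d_r(x,y)=|\mathrm{shape}(x-y)|'$. An $(nr,M,d)$ ordered code is a set of $M$ vectors of $\mathcal Q^{r,n}$ such that the ordered distance between any two distinct ones is at least $d$. A set of coordinates is left-adjusted if with any coordinate it contains all the preceding coordinates of the same block. An ordered orthogonal array (OOA) of strength $t$, where $0\le t\le nr$, is a subset $A\subseteq\mathcal Q^{r,n}$ for which there is an integer $\theta\ge1$ such that the projection of $A$ on any left-adjusted set of $t$ coordinates contains each of the $q^t$ rows exactly $\theta$ times. Let $\delta_{\rm crit}=1-\frac1r\sum_{i=1}^r q^{-i}$ and $P(e)=\delta_{\rm crit}\,rn-|e|'$. Equip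 the space $V$ of real functions on $\Delta_{r,n}$ with the inner product $\langle u_1,u_2\rangle=\sum_{e\in\Delta_{r,n}}u_1(e)u_2(e)w(e)$, where $$w(e)=q^{-nr}\,\frac{n!}{(n-|e|)!\,e_1!\cdots e_r!}\,(q-1)^{|e|}q^{|e|'-|e|}.$$ For $i\ge0$ let $V_i\subseteq V$ be the subspace of the restrictions to $\Delta_{r,n}$ of real polynomials in $r$ variables of total degree at most $i$, let $E_i$ be the orthogonal projection of $V$ on $V_i$, let $S_i:V_i\to V_i$ be the operator $f\mapsto E_i(Pf)$, and let $\lambda_i$ be the maximum eigenvalue of $S_i$. **Theorem.** Let $d\ge1$ and $1\le\kappa\le n-1$ be integers such that $P(e)\le\lambda_{\kappa-1}$ for all $e\in\Delta_{r,n}$ with $|e|'\ge d$. Then any $(nr,M,d)$ ordered code satisfies $$M\le\frac{4r\delta_{\rm crit}(n-\kappa)(q^r-1)^\kappa}{\delta_{\rm crit}rn-\lambda_\kappa}\binom n\kappa,$$ and any OOA $A\subseteq\mathcal Q^{r,n}$ of strength $t=d-1$ and size $M$ satisfies $$M\ge\frac{q^{nr}}{\binom n\kappa}\,\frac{\delta_{\rm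 crit}rn-\lambda_\kappa}{4r\delta_{\rm crit}(n-\kappa)(q^r-1)^\kappa}.$$ -/

import Mathlib

open Finset

noncomputable section

namespace OrderedHamming

/-! ### Shapes

A coordinate `i : Fin r` stands for the position `i + 1` of the mathematical indexing `1, …, r`. -/

/-- The set of shapes `Δ_{r,n} = {e ∈ ℕ^r : ∑ e_i ≤ n}`, as a finite set. -/
def Delta (r n : ℕ) : Finset (Fin r → ℕ) :=
  (Fintype.piFinset fun _ => Finset.range (n + 1)).filter fun e => ∑ i, e i ≤ n

theorem mem_Delta {r n : ℕ} {e : Fin r → ℕ} : e ∈ Delta r n ↔ ∑ i, e i ≤ n := by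
  simp only [Delta, mem_filter, Fintype.mem_piFinset, mem_range, and_iff_right_iff_imp]
  intro h i
  exact Nat.lt_succ_of_le ((single_le_sum (fun j _ => Nat.zero_le (e j)) (mem_univ i)).trans h)

/-- `|e| = ∑ e_i`. -/
def size {r : ℕ} (e : Fin r → ℕ) : ℕ := ∑ i, e i

/-- `|e|' = ∑ i e_i` (with `i` running over `1, …, r`). -/
def height {r : ℕ} (e : Fin r → ℕ) : ℕ := ∑ i : Fin r, ((i : ℕ) + 1) * e i

/-! ### The ordered Hamming space, ordered codes and ordered orthogonal arrays -/

/-- Vectors of `n` blocks of length `r` over the alphabet `Q`. -/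
abbrev Vec (Q : Type*) (r n : ℕ) := Fin n → Fin r → Q

section Codes

variable {Q : Type*} {r n : ℕ}

open Classical in
/-- The position, counted from `1`, of the rightmost nonzero entry of a block;
it is `0` for the zero block. -/
def blockWeight [Zero Q] (b : Fin r → Q) : ℕ :=
  Finset.univ.sup fun j : Fin r => if b j ≠ 0 then (j : ℕ) + 1 else 0

/-- The shape `(e_1, …, e_r)` of a vector: `e_i` is the number of blocks whose rightmost nonzero
entry is in position `i`. -/
def shape [Zero Q] (x : Vec Q r n) : Fin r → ℕ :=
  fun i => #{k : Fin n | blockWeight (x k) = (i : ℕ) + 1}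

/-- The ordered weight. -/
def weight [Zero Q] (x : Vec Q r n) : ℕ := height (shape x)

/-- The ordered distance. -/
def odist [AddGroup Q] (x y : Vec Q r n) : ℕ := weight (x - y)

/-- `C` is an `(nr, M, d)` ordered code with `M = #C`: distinct vectors are at ordered
distance at least `d`. -/
def IsOrderedCode [AddGroup Q] (C : Finset (Vec Q r n)) (d : ℕ) : Prop :=
  ∀ x ∈ C, ∀ y ∈ C, x ≠ y → d ≤ odist x y

/-- A set of coordinates is left-adjusted if with any coordinate it contains all the preceding
coordinates of the same block. -/
def LeftAdjusted (I : Finset (Fin n × Fin r)) : Prop :=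
  ∀ (k : Fin n) (j : Fin r), (k, j) ∈ I → ∀ j' : Fin r, j' < j → (k, j') ∈ I

open Classical in
/-- `A` is an ordered orthogonal array of strength `t` (where `0 ≤ t ≤ nr`): for some index
`θ ≥ 1`, the projection of `A` on any left-adjusted set of `t` coordinates contains each of the
`q ^ t` rows exactly `θ` times. -/
def IsOOA (A : Finset (Vec Q r n)) (t : ℕ) : Prop :=
  t ≤ n * r ∧ ∃ θ : ℕ, 1 ≤ θ ∧ ∀ I : Finset (Fin n × Fin r), LeftAdjusted I → #I = t →
    ∀ row : I → Q, #{x ∈ A | ∀ p : I, x p.1.1 p.1.2 = row p} = θ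

end Codes

/-! ### The numerical parameters -/

/-- `δ_crit = 1 - (1/r) ∑_{i=1}^r q^{-i}`. -/
def deltaCrit (q r : ℕ) : ℝ := 1 - 1 / (r : ℝ) * ∑ i ∈ Finset.Icc 1 r, ((q : ℝ) ^ i)⁻¹

/-- The linear polynomial `P(e) = δ_crit r n - |e|'`. -/
def P (q r n : ℕ) (e : Fin r → ℕ) : ℝ := deltaCrit q r * r * n - height e

/-- The number `v_e = n! / (e_0! e_1! ⋯ e_r!) (q-1)^{|e|} q^{|e|'-|e|}` of vectors of shape `e`,
where `e_0 = n - |e|`. -/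
def valency (q r n : ℕ) (e : Fin r → ℕ) : ℝ :=
  ((n.factorial : ℝ) / (((n - size e).factorial : ℝ) * ∏ i, ((e i).factorial : ℝ))) *
    ((q : ℝ) - 1) ^ size e * (q : ℝ) ^ (height e - size e)

/-- The multinomial probability weight `w(e) = q^{-nr} v_e`. -/
def wt (q r n : ℕ) (e : Fin r → ℕ) : ℝ := ((q : ℝ) ^ (n * r))⁻¹ * valency q r n e

theorem wt_pos {q r n : ℕ} (hq : 1 < q) (e : Fin r → ℕ) : 0 < wt q r n e := by
  have h1 : (0 : ℝ) < (q : ℝ) - 1 := by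
    have : (1 : ℝ) < q := by exact_mod_cast hq
    linarith
  have h2 : (0 : ℝ) < q := by linarith
  have h3 : (0 : ℝ) < ∏ i, ((e i).factorial : ℝ) :=
    Finset.prod_pos fun i _ => by exact_mod_cast Nat.factorial_pos (e i)
  unfold wt valency
  positivity

/-! ### The space of functions on shapes, and the operators `S_κ` -/

/-- The space `V` of real functions on `Δ_{r,n}` (every such function is a polynomial in the `r`
discrete variables), with the inner product `⟨u₁, u₂⟩ = ∑_e u₁(e) u₂(e) w(e)`.
The alphabet `Q` is recorded because `w` depends on `q = |Q|`. -/
def FunSpace (_Q : Type*) (r n : ℕ) : Type := Delta r n → ℝ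

section Space

variable (Q : Type*) (r n : ℕ)

instance : AddCommGroup (FunSpace Q r n) := inferInstanceAs (AddCommGroup (Delta r n → ℝ))
instance : Module ℝ (FunSpace Q r n) := inferInstanceAs (Module ℝ (Delta r n → ℝ))
instance : Module.Finite ℝ (FunSpace Q r n) :=
  inferInstanceAs (Module.Finite ℝ (Delta r n → ℝ))

/-- The inner product on `V`, for the alphabet size `q = |Q| ≥ 2`. -/
@[reducible] def innerCore [Fintype Q] [Nontrivial Q] : InnerProductSpace.Core ℝ (FunSpace Q r n) where
  inner := fun (u v : Delta r n → ℝ) => ∑ e, u e * v e * wt (Fintype.card Q) r n e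
  conj_inner_symm u v := by
    simp only [conj_trivial]
    exact Finset.sum_congr rfl fun e _ => by ring
  re_inner_nonneg u :=
    Finset.sum_nonneg fun e _ =>
      mul_nonneg (mul_self_nonneg _) (wt_pos Fintype.one_lt_card _).le
  add_left u v z := by
    rw [← Finset.sum_add_distrib]
    refine Finset.sum_congr rfl fun e _ => ?_
    change ((u e : ℝ) + v e) * z e * _ = _
    ring
  smul_left u v c := by
    rw [conj_trivial, Finset.mul_sum]
    refine Finset.sum_congr rfl fun e _ => ?_
    change (c * u e) * v e * _ = _
    ring
  definite u hu := by
    funext e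
    have h := (Finset.sum_eq_zero_iff_of_nonneg fun e _ =>
      mul_nonneg (mul_self_nonneg (u e))
        (wt_pos (Fintype.one_lt_card (α := Q)) (e : Fin r → ℕ) (n := n)).le).1 hu e (mem_univ e)
    rcases mul_eq_zero.1 h with h | h
    · exact mul_self_eq_zero.1 h
    · exact absurd h (wt_pos Fintype.one_lt_card _).ne'

instance [Fintype Q] [Nontrivial Q] : NormedAddCommGroup (FunSpace Q r n) :=
  (innerCore Q r n).toNormedAddCommGroup

instance [Fintype Q] [Nontrivial Q] : InnerProductSpace ℝ (FunSpace Q r n) :=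
  InnerProductSpace.ofCore (innerCore Q r n).toCore

theorem inner_def [Fintype Q] [Nontrivial Q] (u v : FunSpace Q r n) :
    inner ℝ u v = ∑ e : Delta r n, u e * v e * wt (Fintype.card Q) r n e := rfl

/-- Restriction of a real polynomial in `x_1, …, x_r` to `Δ_{r,n}`. -/
def evalMap : MvPolynomial (Fin r) ℝ →ₗ[ℝ] FunSpace Q r n :=
  (LinearMap.pi fun e : Delta r n =>
    (MvPolynomial.aeval (R := ℝ) fun i => ((e : Fin r → ℕ) i : ℝ)).toLinearMap :
      MvPolynomial (Fin r) ℝ →ₗ[ℝ] (Delta r n → ℝ))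

/-- `V_κ ⊆ V`, the polynomials of total degree at most `κ`. -/
def polySpace (κ : ℕ) : Submodule ℝ (FunSpace Q r n) :=
  (MvPolynomial.restrictTotalDegree (Fin r) ℝ κ).map (evalMap Q r n)

/-- Multiplication by `P` on `V`. -/
def mulP [Fintype Q] : FunSpace Q r n →ₗ[ℝ] FunSpace Q r n :=
  (LinearMap.mulLeft ℝ (fun e : Delta r n => P (Fintype.card Q) r n e) :
    (Delta r n → ℝ) →ₗ[ℝ] (Delta r n → ℝ))

variable [Fintype Q] [Nontrivial Q]

/-- The operator `S_κ : V_κ → V_κ`, `f ↦ E_κ (P f)`, where `E_κ` is the orthogonal projection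
of `V` on `V_κ`. -/
def S (κ : ℕ) : polySpace Q r n κ →ₗ[ℝ] polySpace Q r n κ :=
  (polySpace Q r n κ).orthogonalProjectionOnto.toLinearMap ∘ₗ mulP Q r n ∘ₗ
    (polySpace Q r n κ).subtype

/-- The maximum eigenvalue `λ_κ` of `S_κ`. -/
def topEigenvalue (κ : ℕ) : ℝ := sSup {μ : ℝ | Module.End.HasEigenvalue (S Q r n κ) μ}

theorem S_isSymmetric (κ : ℕ) : (S Q r n κ).IsSymmetric := by
  intro u v
  have h1 : inner ℝ (S Q r n κ u) v = inner ℝ (mulP Q r n u) (v : FunSpace Q r n) :=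
    Submodule.inner_orthogonalProjectionOnto_eq_of_mem_right v _
  have h2 : inner ℝ u (S Q r n κ v) = inner ℝ (u : FunSpace Q r n) (mulP Q r n v) :=
    Submodule.inner_orthogonalProjectionOnto_eq_of_mem_left u _
  rw [h1, h2, inner_def, inner_def]
  refine Finset.sum_congr rfl fun e _ => ?_
  change P _ r n e * (u : FunSpace Q r n) e * _ * _ =
    _ * (P _ r n e * (v : FunSpace Q r n) e) * _
  ring

instance (κ : ℕ) : Nontrivial (polySpace Q r n κ) := by
  refine ⟨⟨⟨evalMap Q r n 1, Submodule.mem_map_of_mem ?_⟩, 0, ?_⟩⟩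
  · rw [MvPolynomial.mem_restrictTotalDegree, MvPolynomial.totalDegree_one]
    exact Nat.zero_le _
  · intro h
    have h1 := congrFun (congrArg Subtype.val h) ⟨0, mem_Delta.2 (by simp)⟩
    change MvPolynomial.aeval (R := ℝ) _ (1 : MvPolynomial (Fin r) ℝ) = (0 : ℝ) at h1
    simp at h1

/-- The supremum above is indeed the largest eigenvalue. -/
theorem topEigenvalue_isGreatest (κ : ℕ) :
    IsGreatest {μ : ℝ | Module.End.HasEigenvalue (S Q r n κ) μ} (topEigenvalue Q r n κ) := by
  have hne : {μ : ℝ | Module.End.HasEigenvalue (S Q r n κ) μ}.Nonempty :=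
    ⟨_, (S_isSymmetric Q r n κ).hasEigenvalue_iSup_of_finiteDimensional⟩
  have hfin : {μ : ℝ | Module.End.HasEigenvalue (S Q r n κ) μ}.Finite :=
    Module.End.finite_hasEigenvalue _
  exact ⟨hne.csSup_mem hfin, fun μ hμ => le_csSup hfin.bddAbove hμ⟩

end Space

end OrderedHamming

end

/-!
The bounds come from linear programming in the ordered Hamming scheme, with a spectral choice of the
test function.

Let `K_a` be the Krawtchouk functions, the symmetrized characters of the ordered Hamming space. If
`F = ∑ F_a K_a` has nonnegative coefficients and `F ≤ 0` at all distances `≥ d`, then summing `F`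
over the differences of a code of distance `d` gives `M ≤ F(0) / F_0` (`card_code_mul_le`). By the
self-duality of the scheme, summing instead over the dual weights of an array of strength `d - 1`
gives `|A| ≥ q ^ (n r) F_0 / F(0)` (`transform_le_card_OOA_mul`).

The test function is `F = (P - μ) g²`. Here `μ` is the largest eigenvalue, and `g` an eigenvector,
of `S_κ - θ Π_κ` on `V_κ`, where `Π_κ` projects on the terms of degree exactly `κ` and `θ > 0`.
Since `P` itself has nonnegative coefficients, taking absolute values of the coefficients of `g`
does not decrease its Rayleigh quotient, so that `g` may be taken with nonnegative coefficients
(`exists_nonneg_eigenvector`). Then `(P - μ) g = θ Π_κ g + h`, where `h ≥ 0` (in coefficients) is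
the part of degree `κ + 1` of `P g`, so `F` has nonnegative coefficients and `F_0 = θ ‖Π_κ g‖²`.
Comparing Rayleigh quotients, `λ_{κ-1} ≤ μ ≤ λ_κ`: the first inequality makes `F ≤ 0` at all
distances `≥ d`. As each term of degree `κ` leaves `n - κ` blocks free,
`h(0) = (n - κ) r δ_crit (Π_κ g)(0)` (`exists_topPart`), whence
`(P(0) - μ) g(0) = (θ + (n - κ) r δ_crit) (Π_κ g)(0)`. The Cauchy–Schwarz inequality bounds
`(Π_κ g)(0)²` by `‖Π_κ g‖²` times the number `C(n, κ) (q ^ r - 1) ^ κ` of characters of degree `κ`,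
and `θ = (n - κ) r δ_crit` gives the constant `4` (`certificate`, `exists_certificate`).

Characters are avoided: shapes are refined to profiles, the lists of the weights of all blocks. On
profiles the Krawtchouk functions are products of functions of one block, their matrix is
an involution up to the factor `q ^ (n r)`, and everything reduces to identities for one block. The
space `V` consists of the functions on profiles that are invariant under permutations of the blocks,
and `V_κ` of those with coefficients of degree at most `κ` (`polySpace_eq`).
-/

noncomputable section

namespace OrderedHamming

/-! ### Krawtchouk functions of a single block -/

/-- The number of blocks of weight `j`, as a polynomial in the alphabet size `q`. -/
def blockVal (q : ℝ) : ℕ → ℝ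
  | 0 => 1
  | j + 1 => (q - 1) * q ^ j

/-- `q ^ i` times the indicator function of the weights `j ≤ r - i`, that is, of the subgroup of
blocks whose last `i` entries vanish. -/
def blockInd (q : ℝ) (r i j : ℕ) : ℝ := if i + j ≤ r then q ^ i else 0

/-- The `i`-th Krawtchouk function of one block, evaluated at the weight `j`: the sum, at a block of
weight `j`, of the characters trivial on the blocks with vanishing last `i` entries, but not on
those with vanishing last `i - 1` entries. -/
def blockKraw (q : ℝ) (r : ℕ) : ℕ → ℕ → ℝ
  | 0, j => blockInd q r 0 j
  | i + 1, j => blockInd q r (i + 1) j - blockInd q r i j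

section Block

variable {q : ℝ} {r : ℕ}

theorem blockVal_pos (hq : 1 < q) (j : ℕ) : 0 < blockVal q j := by
  cases j with
  | zero => exact one_pos
  | succ j =>
    have : 0 < q - 1 := by linarith
    unfold blockVal
    positivity

theorem sum_blockVal (s : ℕ) : ∑ j ∈ range (s + 1), blockVal q j = q ^ s := by
  induction s with
  | zero => simp [blockVal]
  | succ s ih => rw [sum_range_succ, ih, blockVal]; ring

theorem sum_blockInd_mul_blockVal {i : ℕ} (hi : i ≤ r) :
    ∑ j ∈ range (r + 1), blockInd q r i j * blockVal q j = q ^ r := by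
  have h : range (r - i + 1) ⊆ range (r + 1) := range_subset_range.2 (by omega)
  have hpow : q ^ r = q ^ i * q ^ (r - i) := by rw [← pow_add, Nat.add_sub_cancel' hi]
  rw [← sum_subset h, hpow, ← sum_blockVal (r - i), mul_sum]
  · refine sum_congr rfl fun j hj => ?_
    rw [mem_range] at hj
    rw [blockInd, if_pos (by omega)]
  · intro j _ hj
    rw [mem_range] at hj
    rw [blockInd, if_neg (by omega), zero_mul]

theorem blockInd_mul {i i' : ℕ} (h : i ≤ i') (j : ℕ) :
    blockInd q r i j * blockInd q r i' j = q ^ i * blockInd q r i' j := by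
  unfold blockInd
  split_ifs <;> first | omega | ring

theorem blockInd_eq_sum (i j : ℕ) :
    blockInd q r i j = ∑ l ∈ range (i + 1), blockKraw q r l j := by
  induction i with
  | zero => simp [blockKraw]
  | succ i ih => rw [sum_range_succ, ← ih, blockKraw]; ring

theorem blockKraw_zero_left {j : ℕ} (hj : j ≤ r) : blockKraw q r 0 j = 1 := by
  simp [blockKraw, blockInd, hj]

theorem blockKraw_zero_right {i : ℕ} (hi : i ≤ r) : blockKraw q r i 0 = blockVal q i := by
  cases i with
  | zero => simp [blockKraw, blockInd, blockVal]
  | succ i =>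
    rw [blockKraw, blockInd, blockInd, if_pos (by omega), if_pos (by omega), blockVal]
    ring

/-- Self-duality of the Krawtchouk functions. -/
theorem blockKraw_mul_blockVal {i j : ℕ} (hi : i ≤ r) (hj : j ≤ r) :
    blockKraw q r i j * blockVal q j = blockKraw q r j i * blockVal q i := by
  cases i with
  | zero => rw [blockKraw_zero_left hj, blockKraw_zero_right hj, blockVal]; ring
  | succ i =>
    cases j with
    | zero => rw [blockKraw_zero_left hi, blockKraw_zero_right hi, blockVal]; ring
    | succ j =>
      simp only [blockKraw, blockInd, blockVal]
      split_ifs <;> first | omega | ring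

theorem blockKraw_orthogonal {i i' : ℕ} (hi : i ≤ r) (hi' : i' ≤ r) :
    ∑ j ∈ range (r + 1), blockKraw q r i j * blockKraw q r i' j * blockVal q j =
      if i = i' then q ^ r * blockVal q i else 0 := by
  have key : ∀ {a b : ℕ}, a ≤ b → b ≤ r →
      ∑ j ∈ range (r + 1), blockInd q r a j * blockInd q r b j * blockVal q j
        = q ^ a * q ^ r := by
    intro a b hab hb
    rw [← sum_blockInd_mul_blockVal hb, mul_sum]
    exact sum_congr rfl fun j _ => by rw [blockInd_mul hab, mul_assoc]
  have key' : ∀ {a b : ℕ}, a ≤ b → b ≤ r →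
      ∑ j ∈ range (r + 1), blockInd q r b j * blockInd q r a j * blockVal q j
        = q ^ a * q ^ r := by
    intro a b hab hb
    rw [← key hab hb]
    exact sum_congr rfl fun j _ => by ring
  rcases i with - | i <;> rcases i' with - | i'
  · simp only [blockKraw, if_true]
    rw [key le_rfl hi, blockVal]; ring
  · simp only [blockKraw, mul_sub, sub_mul, sum_sub_distrib]
    rw [key (Nat.zero_le _) hi', key (Nat.zero_le _) (by omega), if_neg (by omega), sub_self]
  · simp only [blockKraw, sub_mul, sum_sub_distrib]
    rw [key' (Nat.zero_le _) hi, key' (Nat.zero_le _) (by omega), if_neg (by omega), sub_self]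
  · simp only [blockKraw, mul_sub, sub_mul, sum_sub_distrib]
    rcases lt_trichotomy i i' with h | h | h
    · rw [key (by omega) hi', key (by omega) (by omega), key (by omega) (by omega),
        key (by omega) (by omega), if_neg (by omega)]
      ring
    · subst h
      rw [key le_rfl hi, key' (by omega) hi, key (by omega) hi, key le_rfl (by omega), if_pos rfl,
        blockVal]
      ring
    · rw [key' (by omega) hi, key' (by omega) (by omega), key' (by omega) (by omega),
        key' (by omega) (by omega), if_neg (by omega)]
      ring

/-- The Krawtchouk matrix of a block is, up to the factor `q ^ r`, an involution. -/
theorem sum_blockKraw_mul_blockKraw (hq : 1 < q) {a b : ℕ} (ha : a ≤ r) (hb : b ≤ r) :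
    ∑ j ∈ range (r + 1), blockKraw q r a j * blockKraw q r j b = if a = b then q ^ r else 0 := by
  have hv := (blockVal_pos hq b).ne'
  rw [← mul_left_inj' hv, sum_mul]
  trans ∑ j ∈ range (r + 1), blockKraw q r a j * blockKraw q r b j * blockVal q j
  · refine sum_congr rfl fun j hj => ?_
    rw [mem_range] at hj
    rw [mul_assoc, mul_assoc, blockKraw_mul_blockVal (i := j) (by omega) hb]
  · rw [blockKraw_orthogonal ha hb]
    split_ifs with h
    · rw [h]
    · rw [zero_mul]

/-- A product of two Krawtchouk functions is a nonnegative combination of Krawtchouk functions. -/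
theorem exists_blockKraw_mul (hq : 2 ≤ q) {a b : ℕ} (ha : a ≤ r) (hb : b ≤ r) :
    ∃ c : ℕ → ℝ, (∀ l, 0 ≤ c l) ∧ ∀ j ≤ r,
      blockKraw q r a j * blockKraw q r b j = ∑ l ∈ range (r + 1), c l * blockKraw q r l j := by
  have h1 : 1 < q := by linarith
  -- The function of larger index is supported where the other one is constant.
  have hlt : ∀ {a b : ℕ}, a < b → b ≤ r → ∀ j ≤ r,
      blockKraw q r a j * blockKraw q r b j = blockVal q a * blockKraw q r b j := by
    intro a b hab hb j hj
    obtain ⟨b, rfl⟩ : ∃ b', b = b' + 1 := ⟨b - 1, by omega⟩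
    cases a with
    | zero => rw [blockKraw_zero_left hj, blockVal]
    | succ a =>
      simp only [blockKraw, blockInd, blockVal]
      split_ifs <;> first | omega | ring
  have single : ∀ {b : ℕ} (x : ℝ), b ≤ r → ∀ j,
      x * blockKraw q r b j = ∑ l ∈ range (r + 1), (if l = b then x else 0) * blockKraw q r l j := by
    intro b x hb j
    rw [sum_eq_single b]
    · simp
    · intro l _ hl
      simp [hl]
    · intro h
      exact absurd (mem_range.2 (by omega)) h
  rcases lt_trichotomy a b with h | h | h
  · refine ⟨fun l => if l = b then blockVal q a else 0, fun l => ?_, fun j hj => ?_⟩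
    · have := (blockVal_pos h1 a).le
      positivity
    · rw [hlt h hb j hj, single _ hb]
  · subst h
    cases a with
    | zero =>
      refine ⟨fun l => if l = 0 then 1 else 0, fun l => by positivity, fun j hj => ?_⟩
      rw [← single 1 hb, blockKraw_zero_left hj]
    | succ a =>
      refine ⟨fun l => (if l = a + 1 then q ^ (a + 1) - 2 * q ^ a else 0) +
        if l ≤ a then q ^ (a + 1) - q ^ a else 0, fun l => ?_, fun j hj => ?_⟩
      · have h2 : 0 ≤ q ^ a := by positivity
        have h3 : 0 ≤ q ^ (a + 1) - 2 * q ^ a := by rw [pow_succ]; nlinarith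
        have h4 : 0 ≤ q ^ (a + 1) - q ^ a := by linarith
        positivity
      · have h5 : ∑ l ∈ range (r + 1), (if l ≤ a then q ^ (a + 1) - q ^ a else 0) *
            blockKraw q r l j = (q ^ (a + 1) - q ^ a) * blockInd q r a j := by
          have h : range (a + 1) ⊆ range (r + 1) := range_subset_range.2 (by omega)
          rw [← sum_subset h, blockInd_eq_sum, mul_sum]
          · refine sum_congr rfl fun l hl => ?_
            rw [mem_range] at hl
            rw [if_pos (by omega)]
          · intro l _ hl
            rw [mem_range] at hl
            rw [if_neg (by omega), zero_mul]
        simp only [add_mul, sum_add_distrib]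
        rw [← single _ hb, h5]
        simp only [blockKraw, blockInd]
        split_ifs <;> first | omega | ring
  · refine ⟨fun l => if l = a then blockVal q b else 0, fun l => ?_, fun j hj => ?_⟩
    · have := (blockVal_pos h1 b).le
      positivity
    · rw [mul_comm, hlt h ha j hj, single _ ha]

/-- The triple sums of Krawtchouk functions, which are multiples of the coefficients of products,
are nonnegative. -/
theorem sum_blockKraw_triple_nonneg (hq : 2 ≤ q) {a b c : ℕ} (ha : a ≤ r) (hb : b ≤ r)
    (hc : c ≤ r) :
    0 ≤ ∑ j ∈ range (r + 1), blockKraw q r a j * blockKraw q r b j * blockKraw q r j c := by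
  obtain ⟨x, hx, h⟩ := exists_blockKraw_mul hq ha hb
  have h1 : 1 < q := by linarith
  have : ∑ j ∈ range (r + 1), blockKraw q r a j * blockKraw q r b j * blockKraw q r j c =
      ∑ l ∈ range (r + 1), x l * if l = c then q ^ r else 0 := by
    trans ∑ j ∈ range (r + 1), ∑ l ∈ range (r + 1),
      x l * (blockKraw q r l j * blockKraw q r j c)
    · refine sum_congr rfl fun j hj => ?_
      rw [h j (by rw [mem_range] at hj; omega), sum_mul]
      exact sum_congr rfl fun l _ => by ring
    · rw [sum_comm]
      refine sum_congr rfl fun l hl => ?_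
      rw [← mul_sum, sum_blockKraw_mul_blockKraw h1 (by rw [mem_range] at hl; omega) hc]
  rw [this]
  refine sum_nonneg fun l _ => mul_nonneg (hx l) ?_
  positivity

/-- The contribution of a block of weight `j` to the linear polynomial `P`. -/
def blockP (q : ℝ) (r j : ℕ) : ℝ := r - ∑ i ∈ Icc 1 r, (q ^ i)⁻¹ - j

theorem blockP_eq_sum_blockInd (hq : 1 < q) {j : ℕ} (hj : j ≤ r) :
    blockP q r j = ∑ i ∈ Icc 1 r, (q ^ i)⁻¹ * (blockInd q r i j - 1) := by
  have h0 : q ≠ 0 := by linarith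
  have h1 : ∑ i ∈ Icc 1 r, (q ^ i)⁻¹ * blockInd q r i j = (r : ℝ) - j := by
    have h : Icc 1 (r - j) ⊆ Icc 1 r := Icc_subset_Icc le_rfl (by omega)
    rw [← sum_subset h]
    · rw [sum_congr rfl (g := fun _ => (1 : ℝ))]
      · simp [Nat.cast_sub hj]
      · intro i hi
        rw [mem_Icc] at hi
        rw [blockInd, if_pos (by omega), inv_mul_cancel₀ (pow_ne_zero _ h0)]
    · intro i hi hi'
      rw [mem_Icc] at hi hi'
      rw [blockInd, if_neg (by omega), mul_zero]
  simp only [mul_sub, sum_sub_distrib, h1, mul_one, blockP]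
  ring

theorem exists_blockP_eq (hq : 1 < q) :
    ∃ p : ℕ → ℝ, (∀ l, 0 ≤ p l) ∧ p 0 = 0 ∧ ∀ j ≤ r,
      blockP q r j = ∑ l ∈ range (r + 1), p l * blockKraw q r l j := by
  refine ⟨fun l => if l = 0 then 0 else ∑ i ∈ Icc l r, (q ^ i)⁻¹, fun l => ?_, if_pos rfl,
    fun j hj => ?_⟩
  · dsimp only
    split_ifs
    · exact le_rfl
    · exact sum_nonneg fun i _ => by positivity
  · rw [blockP_eq_sum_blockInd hq hj]
    have h : ∀ i, blockInd q r i j - 1 = ∑ l ∈ Icc 1 i, blockKraw q r l j := by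
      intro i
      rw [blockInd_eq_sum, sum_range_succ', blockKraw_zero_left hj, add_sub_cancel_right,
        range_eq_Ico, sum_Ico_add' (fun l => blockKraw q r l j) 0 i 1]
      rfl
    rw [← sum_subset (s₁ := Icc 1 r) (s₂ := range (r + 1))]
    · simp only [h, mul_sum]
      rw [sum_comm' (t' := Icc 1 r) (s' := fun l => Icc l r)]
      · refine sum_congr rfl fun l hl => ?_
        rw [mem_Icc] at hl
        rw [if_neg (by omega), sum_mul]
      · intro x y
        simp only [mem_Icc]
        omega
    · intro i
      simp only [mem_Icc, mem_range]
      omega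
    · intro i hi hi'
      simp only [mem_Icc, mem_range] at hi hi'
      dsimp only
      rw [if_pos (by omega), zero_mul]

theorem blockP_zero_pos (hq : 2 ≤ q) (hr : 1 ≤ r) : 0 < blockP q r 0 := by
  have h : ∑ i ∈ Icc 1 r, (q ^ i)⁻¹ ≤ ∑ i ∈ Icc 1 r, (1 / 2 : ℝ) := by
    refine sum_le_sum fun i hi => ?_
    rw [mem_Icc] at hi
    have : q ≤ q ^ i := le_self_pow₀ (by linarith) (by omega)
    rw [one_div]
    exact inv_anti₀ two_pos (hq.trans this)
  have h1 : (1 : ℝ) ≤ r := by exact_mod_cast hr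
  simp only [sum_const, Nat.card_Icc, add_tsub_cancel_right, nsmul_eq_mul] at h
  rw [blockP]
  push_cast
  linarith

end Block

/-! ### Krawtchouk functions of several blocks -/

/-- The profiles: the possible lists of weights of the `n` blocks of a vector. -/
abbrev Profile (r n : ℕ) := Fin n → Fin (r + 1)

/-- The number of nonzero entries of a profile, which is the size of its shape. -/
def numNonzero {r n : ℕ} (a : Profile r n) : ℕ := #{k | a k ≠ 0}

/-- The number of vectors with profile `a`. -/
def profVal {r n : ℕ} (q : ℝ) (a : Profile r n) : ℝ := ∏ k, blockVal q (a k)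

/-- The Krawtchouk functions of several blocks are products of those of one block. -/
def kraw {r n : ℕ} (q : ℝ) (a w : Profile r n) : ℝ := ∏ k, blockKraw q r (a k) (w k)

/-- The linear polynomial `P` as a function of the profile. -/
def profP {r n : ℕ} (q : ℝ) (w : Profile r n) : ℝ := ∑ k, blockP q r (w k)

/-- The Fourier transform of functions on profiles. By self-duality it maps a function to its
coefficients in the Krawtchouk functions, multiplied by `q ^ (n * r)`. -/
def transform {r n : ℕ} (q : ℝ) : (Profile r n → ℝ) →ₗ[ℝ] (Profile r n → ℝ) where
  toFun u w := ∑ a, u a * kraw q a w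
  map_add' u v := by
    funext w
    simp only [Pi.add_apply, add_mul, sum_add_distrib]
  map_smul' c u := by
    funext w
    simp only [Pi.smul_apply, smul_eq_mul, RingHom.id_apply, mul_sum, mul_assoc]

section Profiles

variable {q : ℝ} {r n : ℕ}

theorem transform_apply (u : Profile r n → ℝ) (w : Profile r n) :
    transform q u w = ∑ a, u a * kraw q a w := rfl

theorem profVal_pos (hq : 1 < q) (a : Profile r n) : 0 < profVal q a :=
  prod_pos fun _ _ => blockVal_pos hq _

theorem kraw_zero_left (w : Profile r n) : kraw q 0 w = 1 :=
  prod_eq_one fun k _ => blockKraw_zero_left (Nat.le_of_lt_succ (w k).2)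

theorem kraw_zero_right (a : Profile r n) : kraw q a 0 = profVal q a :=
  prod_congr rfl fun k _ => blockKraw_zero_right (Nat.le_of_lt_succ (a k).2)

theorem kraw_mul_profVal (a w : Profile r n) :
    kraw q a w * profVal q w = kraw q w a * profVal q a := by
  simp only [kraw, profVal, ← prod_mul_distrib]
  exact prod_congr rfl fun k _ =>
    blockKraw_mul_blockVal (Nat.le_of_lt_succ (a k).2) (Nat.le_of_lt_succ (w k).2)

theorem sum_prod_profile (f : Fin n → ℕ → ℝ) :
    ∑ w : Profile r n, ∏ k, f k (w k) = ∏ k, ∑ j ∈ range (r + 1), f k j := by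
  rw [Finset.prod_congr rfl fun k _ => (Fin.sum_univ_eq_sum_range (f k) (r + 1)).symm,
    prod_univ_sum, Fintype.piFinset_univ]

theorem sum_kraw_mul_kraw (hq : 1 < q) (a b : Profile r n) :
    ∑ w, kraw q a w * kraw q w b = if a = b then q ^ (n * r) else 0 := by
  simp only [kraw, ← prod_mul_distrib]
  rw [sum_prod_profile fun k j => blockKraw q r (a k) j * blockKraw q r j (b k)]
  rw [prod_congr rfl fun k _ => sum_blockKraw_mul_blockKraw hq (Nat.le_of_lt_succ (a k).2)
    (Nat.le_of_lt_succ (b k).2)]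
  split_ifs with h
  · subst h
    simp [← pow_mul, mul_comm]
  · obtain ⟨k, hk⟩ := Function.ne_iff.1 h
    exact prod_eq_zero (mem_univ k) (if_neg fun h' => hk (Fin.ext h'))

theorem transform_transform (hq : 1 < q) (u : Profile r n → ℝ) :
    transform q (transform q u) = q ^ (n * r) • u := by
  funext b
  simp only [transform_apply, sum_mul, Pi.smul_apply, smul_eq_mul]
  rw [sum_comm, sum_eq_single b]
  · simp only [mul_assoc, ← mul_sum]
    rw [sum_kraw_mul_kraw hq, if_pos rfl, mul_comm]
  · intro a _ hab
    simp only [mul_assoc, ← mul_sum]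
    rw [sum_kraw_mul_kraw hq, if_neg hab, mul_zero]
  · exact fun h => absurd (mem_univ b) h

theorem transform_injective (hq : 1 < q) :
    Function.Injective (transform q : (Profile r n → ℝ) → _) := by
  intro u v h
  have h1 := congrArg (transform q) h
  rw [transform_transform hq, transform_transform hq] at h1
  exact smul_right_injective _ (pow_ne_zero _ (by linarith : q ≠ 0)) h1

/-- Parseval's identity. -/
theorem sum_transform_mul_transform (hq : 1 < q) (x y : Profile r n → ℝ) :
    ∑ w, transform q x w * transform q y w * profVal q w =
      q ^ (n * r) * ∑ a, x a * y a * profVal q a := by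
  trans ∑ a, x a * profVal q a * transform q (transform q y) a
  · simp only [transform_apply (transform q y), mul_sum]
    rw [sum_comm]
    refine sum_congr rfl fun w _ => ?_
    rw [transform_apply x, sum_mul, sum_mul]
    refine sum_congr rfl fun a _ => ?_
    linear_combination (x a * transform q y w) * kraw_mul_profVal (q := q) a w
  · rw [transform_transform hq, mul_sum]
    refine sum_congr rfl fun a _ => ?_
    simp only [Pi.smul_apply, smul_eq_mul]
    ring

theorem transform_zero_apply (u : Profile r n → ℝ) :
    transform q u 0 = ∑ a, u a * profVal q a := by
  simp only [transform_apply, kraw_zero_right]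

theorem kraw_comp_perm (σ : Equiv.Perm (Fin n)) (a w : Profile r n) :
    kraw q (a ∘ σ) (w ∘ σ) = kraw q a w :=
  Equiv.prod_comp σ fun k => blockKraw q r (a k) (w k)

theorem transform_comp_perm {u : Profile r n → ℝ} (σ : Equiv.Perm (Fin n))
    (hu : ∀ a, u (a ∘ σ) = u a) (w : Profile r n) :
    transform q u (w ∘ σ) = transform q u w := by
  rw [transform_apply, transform_apply]
  refine (Fintype.sum_equiv (σ.symm.arrowCongr (Equiv.refl _)) _ _ fun a => ?_).symm
  have h : (σ.symm.arrowCongr (Equiv.refl (Fin (r + 1)))) a = a ∘ σ := by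
    funext k
    simp [Equiv.arrowCongr]
  rw [h, hu, kraw_comp_perm]

theorem numNonzero_comp_perm (σ : Equiv.Perm (Fin n)) (a : Profile r n) :
    numNonzero (a ∘ σ) = numNonzero a := by
  refine card_equiv σ fun k => ?_
  simp

theorem sum_profVal_of_numNonzero_eq (κ : ℕ) :
    ∑ a : Profile r n with numNonzero a = κ, profVal q a = (n.choose κ : ℝ) * (q ^ r - 1) ^ κ := by
  have hs : ∀ s : Finset (Fin n),
      ∑ a : Profile r n with univ.filter (fun k => a k ≠ 0) = s, profVal q a =
        (q ^ r - 1) ^ #s := by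
    intro s
    have h1 : ∀ a : Profile r n, (if univ.filter (fun k => a k ≠ 0) = s then profVal q a else 0) =
        ∏ k, if ((a k : ℕ) ≠ 0 ↔ k ∈ s) then blockVal q (a k) else 0 := by
      intro a
      split_ifs with h
      · refine prod_congr rfl fun k _ => (if_pos ?_).symm
        rw [← h]
        simp
      · rw [Finset.ext_iff] at h
        push Not at h
        obtain ⟨k, hk⟩ := h
        refine (prod_eq_zero (mem_univ k) (if_neg ?_)).symm
        simp only [mem_filter, mem_univ, true_and] at hk
        rw [← Fin.val_ne_zero_iff] at hk
        tauto
    rw [sum_filter, sum_congr rfl fun a _ => h1 a,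
      sum_prod_profile fun k j => if (j ≠ 0 ↔ k ∈ s) then blockVal q j else 0]
    rw [prod_congr rfl (g := fun k => if k ∈ s then q ^ r - 1 else 1)]
    · rw [prod_ite_mem, univ_inter, prod_const]
    · intro k _
      have h2 := sum_blockVal (q := q) r
      rw [sum_range_succ'] at h2 ⊢
      by_cases hk : k ∈ s
      · simp only [hk, iff_true, ne_eq, Nat.add_eq_zero_iff, one_ne_zero, and_false,
          not_false_eq_true, if_true, not_true_eq_false, if_false]
        rw [← h2, blockVal]
        ring
      · simp [hk, blockVal]
  rw [← sum_fiberwise_of_maps_to (t := powersetCard κ univ)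
    (g := fun a : Profile r n => univ.filter (fun k => a k ≠ 0))]
  · rw [sum_congr rfl (g := fun _ => (q ^ r - 1) ^ κ)]
    · simp
    · intro s hs'
      rw [mem_powersetCard] at hs'
      rw [← hs'.2, ← hs s, filter_filter]
      refine sum_congr (filter_congr fun a _ => ?_) fun _ _ => rfl
      constructor
      · exact fun h => h.2
      · exact fun h => ⟨by rw [numNonzero, h], h⟩
  · intro a ha
    rw [mem_filter] at ha
    exact mem_powersetCard.2 ⟨subset_univ _, ha.2⟩

theorem transform_mul_apply (hq : 1 < q) (u v : Profile r n → ℝ) (c : Profile r n) :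
    transform q (u * v) c = (q ^ (n * r))⁻¹ * (q ^ (n * r))⁻¹ *
      ∑ a, ∑ b, transform q u a * transform q v b *
        ∑ w, kraw q a w * kraw q b w * kraw q w c := by
  have hpos : 0 < q ^ (n * r) := by positivity
  have hexp : ∀ (u : Profile r n → ℝ) w,
      u w = (q ^ (n * r))⁻¹ * ∑ a, transform q u a * kraw q a w := by
    intro u w
    rw [← transform_apply, transform_transform hq, Pi.smul_apply, smul_eq_mul,
      inv_mul_cancel_left₀ hpos.ne']
  simp only [mul_sum]
  rw [sum_congr rfl fun a _ => sum_comm, sum_comm, transform_apply]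
  refine sum_congr rfl fun w _ => ?_
  rw [Pi.mul_apply, hexp u, hexp v, mul_mul_mul_comm, sum_mul_sum, mul_sum, sum_mul]
  refine sum_congr rfl fun a _ => ?_
  rw [mul_sum, sum_mul]
  exact sum_congr rfl fun b _ => by ring

/-! ### Positive definite functions -/

/-- A function on profiles is positive definite if its Krawtchouk coefficients are nonnegative. -/
def PosDefFun (q : ℝ) (u : Profile r n → ℝ) : Prop := ∀ a, 0 ≤ transform q u a

theorem PosDefFun.mul (hq : 2 ≤ q) {u v : Profile r n → ℝ} (hu : PosDefFun q u)
    (hv : PosDefFun q v) : PosDefFun q (u * v) := by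
  intro c
  rw [transform_mul_apply (by linarith)]
  refine mul_nonneg (by positivity) (sum_nonneg fun a _ => sum_nonneg fun b _ =>
    mul_nonneg (mul_nonneg (hu a) (hv b)) ?_)
  simp only [kraw, ← prod_mul_distrib]
  rw [sum_prod_profile fun k j =>
    blockKraw q r (a k) j * blockKraw q r (b k) j * blockKraw q r j (c k)]
  exact prod_nonneg fun k _ => sum_blockKraw_triple_nonneg hq (Nat.le_of_lt_succ (a k).2)
    (Nat.le_of_lt_succ (b k).2) (Nat.le_of_lt_succ (c k).2)

theorem sum_blockP_mul_blockKraw (hq : 1 < q) :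
    ∃ p : ℕ → ℝ, (∀ l, 0 ≤ p l) ∧ p 0 = 0 ∧ ∀ c ≤ r,
      ∑ j ∈ range (r + 1), blockP q r j * blockKraw q r j c = p c * q ^ r := by
  obtain ⟨p, hp, hp0, h⟩ := exists_blockP_eq (r := r) hq
  refine ⟨p, hp, hp0, fun c hc => ?_⟩
  trans ∑ j ∈ range (r + 1), ∑ l ∈ range (r + 1),
    p l * (blockKraw q r l j * blockKraw q r j c)
  · refine sum_congr rfl fun j hj => ?_
    rw [h j (by rw [mem_range] at hj; omega), sum_mul]
    exact sum_congr rfl fun l _ => by ring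
  · rw [sum_comm, sum_eq_single c]
    · rw [← mul_sum, sum_blockKraw_mul_blockKraw hq hc hc, if_pos rfl]
    · intro l hl hlc
      rw [← mul_sum, sum_blockKraw_mul_blockKraw hq (by rw [mem_range] at hl; omega) hc,
        if_neg hlc, mul_zero]
    · intro h
      exact absurd (mem_range.2 (by omega)) h

theorem transform_blockP_mul_kraw (k : Fin n) (a b : Profile r n) :
    transform q (fun w => blockP q r (w k) * kraw q a w) b =
      ∏ l, ∑ j ∈ range (r + 1), (if l = k then blockP q r j else 1) *
        (blockKraw q r (a l) j * blockKraw q r j (b l)) := by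
  rw [← sum_prod_profile fun l j => (if l = k then blockP q r j else 1) *
        (blockKraw q r (a l) j * blockKraw q r j (b l)), transform_apply]
  refine sum_congr rfl fun w _ => ?_
  rw [prod_mul_distrib, prod_mul_distrib, prod_ite_eq' univ k fun l => blockP q r (w l),
    if_pos (mem_univ k), kraw, kraw, mul_assoc]

/-- Multiplication by the contribution of block `k` to `P` changes only the entry `k` of the index
of a Krawtchouk function. -/
theorem transform_blockP_mul_kraw_eq_zero (hq : 1 < q) {k l : Fin n} (hl : l ≠ k)
    {a b : Profile r n} (h : a l ≠ b l) :
    transform q (fun w => blockP q r (w k) * kraw q a w) b = 0 := by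
  rw [transform_blockP_mul_kraw]
  refine prod_eq_zero (mem_univ l) ?_
  simp only [if_neg hl, one_mul]
  rw [sum_blockKraw_mul_blockKraw hq (Nat.le_of_lt_succ (a l).2) (Nat.le_of_lt_succ (b l).2),
    if_neg fun h' => h (Fin.ext h')]

/-- The contribution of block `k` to `P` has mean zero. -/
theorem transform_blockP_mul_kraw_eq_zero_of_eq_zero (hq : 1 < q) {k : Fin n}
    {a b : Profile r n} (ha : a k = 0) (hb : b k = 0) :
    transform q (fun w => blockP q r (w k) * kraw q a w) b = 0 := by
  obtain ⟨p, -, hp0, h⟩ := sum_blockP_mul_blockKraw (r := r) hq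
  rw [transform_blockP_mul_kraw]
  refine prod_eq_zero (mem_univ k) ?_
  rw [← zero_mul (q ^ r), ← hp0, ← h 0 (Nat.zero_le _)]
  refine sum_congr rfl fun j hj => ?_
  rw [mem_range] at hj
  rw [if_pos rfl, ha, hb, Fin.val_zero, blockKraw_zero_left (by omega), one_mul]

theorem posDefFun_profP (hq : 1 < q) : PosDefFun q (profP q : Profile r n → ℝ) := by
  intro b
  obtain ⟨p, hp, -, h⟩ := sum_blockP_mul_blockKraw (r := r) hq
  have : (profP q : Profile r n → ℝ) = ∑ k, fun w => blockP q r (w k) * kraw q 0 w := by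
    funext w
    simp [profP, kraw_zero_left]
  rw [this, map_sum, Finset.sum_apply]
  refine sum_nonneg fun k _ => ?_
  rw [transform_blockP_mul_kraw]
  refine prod_nonneg fun l _ => ?_
  split_ifs
  · rw [sum_congr rfl fun j hj => by
      rw [Pi.zero_apply, Fin.val_zero, blockKraw_zero_left (by rw [mem_range] at hj; omega),
        one_mul], h _ (Nat.le_of_lt_succ (b l).2)]
    have := hp (b l)
    positivity
  · simp only [one_mul, Pi.zero_apply, Fin.val_zero]
    rw [sum_blockKraw_mul_blockKraw hq (Nat.zero_le _) (Nat.le_of_lt_succ (b l).2)]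
    positivity

end Profiles

/-! ### The certificate built from an eigenvector -/

section Certificate

variable {q : ℝ} {r n : ℕ}

theorem numNonzero_eq_add (k : Fin n) (a : Profile r n) :
    numNonzero a = #{l ∈ univ.erase k | a l ≠ 0} + if a k ≠ 0 then 1 else 0 := by
  rw [numNonzero, ← insert_erase (mem_univ k), filter_insert, erase_insert (notMem_erase k univ)]
  split_ifs with h
  · rw [card_insert_of_notMem (by simp)]
  · rfl

theorem numNonzero_add_of_eqOn {k : Fin n} {a b : Profile r n} (h : ∀ l ≠ k, a l = b l) :
    numNonzero b + (if a k ≠ 0 then 1 else 0) = numNonzero a + if b k ≠ 0 then 1 else 0 := by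
  have h2 : #{l ∈ univ.erase k | a l ≠ 0} = #{l ∈ univ.erase k | b l ≠ 0} := by
    congr 1
    exact filter_congr fun l hl => by rw [h l (ne_of_mem_erase hl)]
  rw [numNonzero_eq_add k a, numNonzero_eq_add k b, h2]
  omega

/-- The part of degree `κ + 1` of the product of `P` with a function `g` of degree `κ`. It comes from
multiplying the terms of degree `κ` of `g` by the contributions to `P` of the other `n - κ` blocks,
and these contributions all have the same value at `0`. -/
theorem exists_topPart (hq : 1 < q) (κ : ℕ) (c : Profile r n → ℝ)
    (hc : ∀ a, κ < numNonzero a → c a = 0) :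
    ∃ h : Profile r n → ℝ, (∀ b, numNonzero b ≤ κ → transform q h b = 0) ∧
      (∀ b, κ < numNonzero b → transform q h b = transform q (profP q * transform q c) b) ∧
      h 0 = (n - κ) * blockP q r 0 * ∑ a with numNonzero a = κ, c a * profVal q a := by
  set f : Profile r n → Fin n → Profile r n → ℝ :=
    fun a k w => blockP q r (w k) * kraw q a w with hf
  refine ⟨∑ a with numNonzero a = κ, ∑ k with a k = 0, c a • f a k, fun b hb => ?_, fun b hb => ?_,
    ?_⟩
  · simp only [map_sum, map_smul, Finset.sum_apply, Pi.smul_apply, smul_eq_mul]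
    refine sum_eq_zero fun a ha => sum_eq_zero fun k hk => ?_
    rw [mem_filter] at ha hk
    by_cases h : ∀ l ≠ k, a l = b l
    · have h1 := numNonzero_add_of_eqOn h
      by_cases hbk : b k = 0
      · rw [transform_blockP_mul_kraw_eq_zero_of_eq_zero hq hk.2 hbk, mul_zero]
      · simp only [hk.2, ne_eq, not_true_eq_false, if_false, hbk, not_false_eq_true, if_true] at h1
        omega
    · push Not at h
      obtain ⟨l, hl, hab⟩ := h
      rw [transform_blockP_mul_kraw_eq_zero hq hl hab, mul_zero]
  · have hP : profP q * transform q c = ∑ a, ∑ k, c a • f a k := by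
      funext w
      simp only [Pi.mul_apply, profP, transform_apply, sum_mul_sum, Finset.sum_apply,
        Pi.smul_apply, smul_eq_mul, hf]
      rw [sum_comm]
      exact sum_congr rfl fun a _ => sum_congr rfl fun k _ => by ring
    rw [hP]
    simp only [map_sum, map_smul, Finset.sum_apply, Pi.smul_apply, smul_eq_mul]
    rw [sum_filter]
    refine sum_congr rfl fun a _ => ?_
    -- A change of one entry raises the degree only if that entry was zero.
    have hvan : ∀ k, (numNonzero a < κ ∨ numNonzero a = κ ∧ a k ≠ 0) →
        transform q (f a k) b = 0 := by
      intro k hak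
      by_cases h : ∀ l ≠ k, a l = b l
      · have h1 := numNonzero_add_of_eqOn h
        exfalso
        split_ifs at h1 <;> rcases hak with hak | hak <;> omega
      · push Not at h
        obtain ⟨l, hl, hab⟩ := h
        exact transform_blockP_mul_kraw_eq_zero hq hl hab
    split_ifs with ha
    · rw [sum_filter]
      refine sum_congr rfl fun k _ => ?_
      split_ifs with hk
      · rfl
      · rw [hvan k (Or.inr ⟨ha, hk⟩), mul_zero]
    · refine (sum_eq_zero fun k _ => ?_).symm
      rcases lt_or_gt_of_ne ha with h | h
      · rw [hvan k (Or.inl h), mul_zero]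
      · rw [hc a h, zero_mul]
  · simp only [Finset.sum_apply, Pi.smul_apply, smul_eq_mul, hf, mul_sum]
    refine sum_congr rfl fun a ha => ?_
    rw [mem_filter] at ha
    simp only [Pi.zero_apply, Fin.val_zero, kraw_zero_right, sum_const, nsmul_eq_mul]
    have h1 : #{k | a k = 0} + κ = n := by
      have := card_filter_add_card_filter_not (s := (univ : Finset (Fin n))) (fun k => a k = 0)
      rw [card_univ, Fintype.card_fin] at this
      rw [← ha.2, numNonzero]
      exact this
    have h2 : (#{k | a k = 0} : ℝ) = n - κ := by
      rw [eq_sub_iff_add_eq]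
      exact_mod_cast h1
    rw [h2]
    ring

/-- If `g` has nonnegative coefficients and satisfies the eigenvalue equation of `S_κ - θ Π_κ`, with
`Π_κ` the projection on the terms of degree `κ`, then `(P - μ) g²` is a certificate for the
linear programming bounds; its value at `0` and its mean are computed from the terms of degree `κ`
of `g`. -/
theorem certificate (hq : 2 ≤ q) {κ : ℕ} {c : Profile r n → ℝ} (hc0 : ∀ a, 0 ≤ c a)
    (hc : ∀ a, κ < numNonzero a → c a = 0) {μ θ : ℝ} (hθ : 0 ≤ θ)
    (heig : ∀ a, numNonzero a ≤ κ → transform q (profP q * transform q c) a =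
      q ^ (n * r) * ((μ + if numNonzero a = κ then θ else 0) * c a)) :
    PosDefFun q ((profP q - fun _ => μ) * transform q c * transform q c) ∧
    transform q ((profP q - fun _ => μ) * transform q c * transform q c) 0 =
      q ^ (n * r) * (θ * ∑ a with numNonzero a = κ, c a * c a * profVal q a) ∧
    (profP q (0 : Profile r n) - μ) * transform q c 0 =
      (θ + (n - κ) * blockP q r 0) * ∑ a with numNonzero a = κ, c a * profVal q a := by
  have h1 : 1 < q := by linarith
  have hK : 0 < q ^ (n * r) := by positivity
  obtain ⟨h, hlow, hhigh, hzero⟩ := exists_topPart h1 κ c hc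
  set ck : Profile r n → ℝ := fun a => if numNonzero a = κ then c a else 0 with hck
  have hg : PosDefFun q (transform q c) := by
    intro a
    rw [transform_transform h1, Pi.smul_apply, smul_eq_mul]
    exact mul_nonneg hK.le (hc0 a)
  have hy : (profP q - fun _ => μ) * transform q c = θ • transform q ck + h := by
    apply transform_injective h1
    funext b
    have e : (profP q - fun _ => μ) * transform q c =
        profP q * transform q c - μ • transform q c := by
      funext w
      simp [sub_mul]
    rw [e]
    simp only [map_sub, map_add, map_smul, Pi.sub_apply, Pi.add_apply, Pi.smul_apply, smul_eq_mul,
      transform_transform h1]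
    by_cases hb : numNonzero b ≤ κ
    · rw [heig b hb, hlow b hb, hck]
      dsimp only
      split_ifs <;> ring
    · rw [not_le] at hb
      rw [hhigh b hb, hc b hb, hck]
      dsimp only
      rw [if_neg hb.ne']
      ring
  have hypos : PosDefFun q ((profP q - fun _ => μ) * transform q c) := by
    intro b
    rw [hy]
    simp only [map_add, map_smul, Pi.add_apply, Pi.smul_apply, smul_eq_mul, transform_transform h1]
    have e1 : 0 ≤ ck b := by
      rw [hck]
      dsimp only
      split_ifs
      · exact hc0 b
      · exact le_rfl
    have e2 : 0 ≤ transform q h b := by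
      by_cases hb : numNonzero b ≤ κ
      · rw [hlow b hb]
      · rw [hhigh b (not_le.1 hb)]
        exact (posDefFun_profP h1).mul hq hg b
    positivity
  refine ⟨hypos.mul hq hg, ?_, ?_⟩
  · have hh : h = transform q ((q ^ (n * r))⁻¹ • transform q h) := by
      rw [map_smul, transform_transform h1, smul_smul, inv_mul_cancel₀ hK.ne', one_smul]
    have hy' : θ • transform q ck + h =
        transform q (θ • ck + (q ^ (n * r))⁻¹ • transform q h) := by
      rw [map_add, map_smul, ← hh]
    rw [transform_zero_apply, hy, hy']
    simp only [Pi.mul_apply]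
    rw [sum_transform_mul_transform h1, sum_filter, mul_sum, mul_sum, mul_sum]
    refine sum_congr rfl fun a _ => ?_
    simp only [Pi.add_apply, Pi.smul_apply, smul_eq_mul, hck]
    by_cases ha : numNonzero a ≤ κ
    · rw [hlow a ha]
      split_ifs <;> ring
    · rw [not_le] at ha
      rw [hc a ha]
      simp
  · have h2 := congrFun hy 0
    simp only [Pi.mul_apply, Pi.sub_apply, Pi.add_apply, Pi.smul_apply, smul_eq_mul] at h2
    rw [h2, hzero, transform_zero_apply, sum_filter, add_mul, hck]
    simp only [ite_mul, zero_mul]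

end Certificate

/-! ### Linear programming bounds for ordered codes and ordered orthogonal arrays -/

section Vectors

variable {Q : Type*} {q r n : ℕ}

theorem blockWeight_le_iff [Zero Q] {b : Fin r → Q} {s : ℕ} :
    blockWeight b ≤ s ↔ ∀ j : Fin r, s ≤ j → b j = 0 := by
  rw [blockWeight, Finset.sup_le_iff]
  refine forall_congr' fun j => ?_
  by_cases hb : b j = 0
  · simp [hb]
  · simp only [mem_univ, ne_eq, hb, not_false_eq_true, if_true, true_imp_iff, imp_false]
    omega

theorem blockWeight_le [Zero Q] (b : Fin r → Q) : blockWeight b ≤ r :=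
  blockWeight_le_iff.2 fun j hj => absurd j.2 (by omega)

/-- The profile of a vector: the list of the weights of its blocks. -/
def profile [Zero Q] (x : Vec Q r n) : Profile r n :=
  fun k => ⟨blockWeight (x k), Nat.lt_succ_of_le (blockWeight_le _)⟩

theorem profile_zero [Zero Q] : profile (0 : Vec Q r n) = 0 := by
  funext k
  refine Fin.ext (Nat.le_zero.1 (blockWeight_le_iff.2 fun j _ => rfl))

/-- The shape of the vectors with a given profile. -/
def profileShape (w : Profile r n) : Fin r → ℕ := fun i => #{k | w k = i.succ}

theorem shape_eq [Zero Q] (x : Vec Q r n) : shape x = profileShape (profile x) := by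
  funext i
  simp [shape, profileShape, profile, Fin.ext_iff]

theorem sum_mul_profileShape (f : Fin (r + 1) → ℕ) (hf : f 0 = 0) (w : Profile r n) :
    ∑ i : Fin r, f i.succ * profileShape w i = ∑ k, f (w k) := by
  simp only [profileShape, card_filter, mul_sum, mul_ite, mul_one, mul_zero]
  rw [sum_comm]
  refine sum_congr rfl fun k _ => ?_
  refine Fin.cases ?_ (fun j => ?_) (w k)
  · simp [hf, (Fin.succ_ne_zero _).symm]
  · simp [Fin.succ_inj]

theorem height_profileShape (w : Profile r n) : height (profileShape w) = ∑ k, (w k : ℕ) := by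
  rw [← sum_mul_profileShape (fun j => (j : ℕ)) rfl]
  rfl

theorem size_profileShape (w : Profile r n) : size (profileShape w) = numNonzero w := by
  have h := sum_mul_profileShape (fun j => if j = 0 then 0 else 1) rfl w
  simp only [Fin.succ_ne_zero, if_false, one_mul] at h
  rw [size, h, numNonzero, card_filter]
  exact sum_congr rfl fun k _ => by split_ifs <;> simp_all

theorem blockInd_blockWeight_sub [AddGroup Q] (c : ℝ) {i : ℕ} (hi : i ≤ r) (x y : Fin r → Q)
    [Decidable (∀ j : Fin r, r - i ≤ j → x j = y j)] :
    blockInd c r i (blockWeight (x - y)) =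
      if ∀ j : Fin r, r - i ≤ j → x j = y j then c ^ i else 0 := by
  rw [blockInd]
  refine if_congr ?_ rfl rfl
  rw [← Nat.le_sub_iff_add_le' hi, blockWeight_le_iff]
  exact forall₂_congr fun j _ => sub_eq_zero

theorem sum_prod_vec [Fintype Q] (f : Fin n → (Fin r → Q) → ℝ) :
    ∑ z : Vec Q r n, ∏ k, f k (z k) = ∏ k, ∑ b, f k b := by
  classical
  rw [prod_univ_sum, Fintype.piFinset_univ]

open Classical in
theorem card_eqOn_tail [Fintype Q] (hq : Fintype.card Q = q) {s : ℕ} (hs : s ≤ r) (y : Fin r → Q) :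
    #{z : Fin r → Q | ∀ j : Fin r, s ≤ j → y j = z j} = q ^ s := by
  have h : ({z : Fin r → Q | ∀ j : Fin r, s ≤ j → y j = z j} : Finset (Fin r → Q)) =
      Fintype.piFinset fun j : Fin r => if s ≤ j then {y j} else univ := by
    ext z
    simp only [mem_filter, mem_univ, true_and, Fintype.mem_piFinset]
    refine forall_congr' fun j => ?_
    split_ifs with hj <;> simp [hj, eq_comm]
  have h2 : ∀ j : Fin r, #(if s ≤ (j : ℕ) then {y j} else (univ : Finset Q)) =
      if s ≤ (j : ℕ) then 1 else q := by
    intro j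
    split_ifs
    · exact card_singleton _
    · rw [card_univ, hq]
  rw [h, Fintype.card_piFinset, prod_congr rfl fun j _ => h2 j,
    Fin.prod_univ_eq_prod_range (fun j => if s ≤ j then 1 else q) r, prod_ite, prod_const_one,
    one_mul, prod_const]
  congr 1
  have h3 : (range r).filter (fun j => ¬s ≤ j) = range s := by
    ext j
    simp only [mem_filter, mem_range]
    omega
  rw [h3, card_range]

section Sums

variable [AddCommGroup Q] [Fintype Q]

theorem sum_blockInd_mul_blockInd (hq : Fintype.card Q = q) {i i' : ℕ}
    (hii : i ≤ i') (hi' : i' ≤ r) (x y : Fin r → Q) :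
    ∑ z, blockInd q r i (blockWeight (x - z)) * blockInd q r i' (blockWeight (y - z)) =
      (q : ℝ) ^ r * blockInd q r i (blockWeight (x - y)) := by
  classical
  simp only [blockInd_blockWeight_sub (q : ℝ) (hii.trans hi'), blockInd_blockWeight_sub (q : ℝ) hi']
  split_ifs with h
  · have h1 : ∀ z : Fin r → Q,
        (if ∀ j : Fin r, r - i ≤ j → x j = z j then (q : ℝ) ^ i else 0) *
          (if ∀ j : Fin r, r - i' ≤ j → y j = z j then (q : ℝ) ^ i' else 0) =
        if ∀ j : Fin r, r - i' ≤ j → y j = z j then (q : ℝ) ^ i * q ^ i' else 0 := by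
      intro z
      split_ifs with h2 h3 h3
      · rfl
      · rw [mul_zero]
      · exact absurd (fun j hj => (h j hj).trans (h3 j (by omega))) h2
      · rw [mul_zero]
    rw [sum_congr rfl fun z _ => h1 z, ← sum_filter, sum_const,
      card_eqOn_tail hq (Nat.sub_le r i'), nsmul_eq_mul, Nat.cast_pow]
    have : (q : ℝ) ^ r = q ^ (r - i') * q ^ i' := by rw [← pow_add, Nat.sub_add_cancel hi']
    rw [this]
    ring
  · rw [mul_zero]
    refine sum_eq_zero fun z _ => ?_
    split_ifs with h2 h3
    · exact absurd (fun j hj => (h2 j hj).trans (h3 j (by omega)).symm) h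
    all_goals simp

theorem sum_blockInd (hq : Fintype.card Q = q) {i : ℕ} (hi : i ≤ r) (x : Fin r → Q) :
    ∑ z, blockInd q r i (blockWeight (x - z)) = (q : ℝ) ^ r := by
  classical
  simp only [blockInd_blockWeight_sub (q : ℝ) hi]
  rw [← sum_filter, sum_const, card_eqOn_tail hq (Nat.sub_le r i), nsmul_eq_mul, Nat.cast_pow,
    ← pow_add, Nat.sub_add_cancel hi]

/-- The Krawtchouk functions of a block are, up to a factor, convolution idempotents. -/
theorem sum_blockKraw_mul_blockKraw_sub (hq : Fintype.card Q = q) {i : ℕ}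
    (hi : i ≤ r) (x y : Fin r → Q) :
    ∑ z, blockKraw q r i (blockWeight (x - z)) * blockKraw q r i (blockWeight (y - z)) =
      (q : ℝ) ^ r * blockKraw q r i (blockWeight (x - y)) := by
  have hsymm : ∀ i ≤ r, blockInd q r i (blockWeight (y - x)) =
      blockInd q r i (blockWeight (x - y)) := by
    classical
    intro i hi
    simp only [blockInd_blockWeight_sub (q : ℝ) hi, eq_comm]
  cases i with
  | zero => simpa only [blockKraw] using sum_blockInd_mul_blockInd hq le_rfl hi x y
  | succ i =>
    have h1 := sum_blockInd_mul_blockInd hq (Nat.le_add_right i 1) hi y x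
    simp only [mul_comm (blockInd (q : ℝ) r i _)] at h1
    simp only [blockKraw, mul_sub, sub_mul, sum_sub_distrib]
    rw [sum_blockInd_mul_blockInd hq le_rfl hi, h1,
      sum_blockInd_mul_blockInd hq (Nat.le_add_right i 1) hi,
      sum_blockInd_mul_blockInd hq le_rfl (by omega), hsymm i (by omega)]
    ring

theorem sum_blockKraw_sub (hq : Fintype.card Q = q) {i : ℕ} (hi : i ≤ r) (hi0 : i ≠ 0)
    (x : Fin r → Q) : ∑ z, blockKraw q r i (blockWeight (x - z)) = 0 := by
  obtain ⟨i, rfl⟩ := Nat.exists_eq_succ_of_ne_zero hi0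
  simp only [blockKraw, sum_sub_distrib]
  rw [sum_blockInd hq hi, sum_blockInd hq (by omega), sub_self]

/-- Krawtchouk functions are positive semidefinite kernels. -/
theorem sum_kraw_profile_sub_nonneg (hq : Fintype.card Q = q) (hq0 : 0 < q) (a : Profile r n)
    (C : Finset (Vec Q r n)) :
    0 ≤ ∑ x ∈ C, ∑ y ∈ C, kraw (q : ℝ) a (profile (x - y)) := by
  have h1 : ∀ x y : Vec Q r n, (q : ℝ) ^ (r * n) * kraw (q : ℝ) a (profile (x - y)) =
      ∑ z, kraw (q : ℝ) a (profile (x - z)) * kraw (q : ℝ) a (profile (y - z)) := by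
    intro x y
    have := sum_prod_vec (Q := Q) fun (k : Fin n) (b : Fin r → Q) =>
      blockKraw q r (a k) (blockWeight (x k - b)) * blockKraw q r (a k) (blockWeight (y k - b))
    simp only [sum_blockKraw_mul_blockKraw_sub hq (Nat.le_of_lt_succ (a _).2),
      prod_mul_distrib, prod_const, card_univ, Fintype.card_fin, ← pow_mul] at this
    exact this.symm
  have h2 : (q : ℝ) ^ (r * n) * ∑ x ∈ C, ∑ y ∈ C, kraw (q : ℝ) a (profile (x - y)) =
      ∑ z, (∑ x ∈ C, kraw (q : ℝ) a (profile (x - z))) ^ 2 := by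
    simp only [sq, sum_mul_sum]
    simp only [mul_sum, h1]
    rw [sum_congr rfl fun x _ => sum_comm, sum_comm]
  have h3 : (0 : ℝ) < (q : ℝ) ^ (r * n) := by positivity
  refine (mul_nonneg_iff_of_pos_left h3).1 ?_
  rw [h2]
  exact sum_nonneg fun z _ => sq_nonneg _

theorem transform_transform_apply (hq : 1 < q) (F : Profile r n → ℝ) (w : Profile r n) :
    (q : ℝ) ^ (n * r) * F w = ∑ a, transform (q : ℝ) F a * kraw (q : ℝ) a w := by
  rw [← transform_apply, transform_transform (by exact_mod_cast hq), Pi.smul_apply, smul_eq_mul]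

/-- The linear programming bound for ordered codes. -/
theorem card_code_mul_le (hq : Fintype.card Q = q) (hq1 : 1 < q) {F : Profile r n → ℝ}
    (hF : PosDefFun (q : ℝ) F) {d : ℕ} (hneg : ∀ w, d ≤ ∑ k, (w k : ℕ) → F w ≤ 0)
    {C : Finset (Vec Q r n)} (hC : IsOrderedCode C d) :
    #C * transform (q : ℝ) F 0 ≤ (q : ℝ) ^ (n * r) * F 0 := by
  classical
  rcases C.eq_empty_or_nonempty with rfl | hne
  · rw [card_empty, Nat.cast_zero, zero_mul, transform_transform_apply hq1]
    refine sum_nonneg fun a _ => mul_nonneg (hF a) ?_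
    rw [kraw_zero_right]
    exact (profVal_pos (by exact_mod_cast hq1) a).le
  have hM : (0 : ℝ) < #C := by exact_mod_cast hne.card_pos
  have hK : (0 : ℝ) ≤ (q : ℝ) ^ (n * r) := by positivity
  refine le_of_mul_le_mul_left ?_ hM
  calc (#C : ℝ) * (#C * transform (q : ℝ) F 0)
      = transform (q : ℝ) F 0 * ∑ x ∈ C, ∑ y ∈ C, kraw (q : ℝ) 0 (profile (x - y)) := by
        simp only [kraw_zero_left, sum_const, nsmul_eq_mul, mul_one]
        ring
    _ ≤ ∑ a, transform (q : ℝ) F a * ∑ x ∈ C, ∑ y ∈ C, kraw (q : ℝ) a (profile (x - y)) :=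
        single_le_sum (f := fun a => transform (q : ℝ) F a *
          ∑ x ∈ C, ∑ y ∈ C, kraw (q : ℝ) a (profile (x - y)))
          (fun a _ => mul_nonneg (hF a) (sum_kraw_profile_sub_nonneg hq (by omega) a C))
          (mem_univ 0)
    _ = ∑ x ∈ C, ∑ y ∈ C, (q : ℝ) ^ (n * r) * F (profile (x - y)) := by
        simp only [transform_transform_apply hq1, mul_sum]
        rw [sum_comm]
        exact sum_congr rfl fun x _ => sum_comm
    _ ≤ ∑ x ∈ C, (q : ℝ) ^ (n * r) * F 0 := by
        refine sum_le_sum fun x hx => ?_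
        rw [← add_sum_erase C _ hx, sub_self, profile_zero, add_le_iff_nonpos_right]
        refine sum_nonpos fun y hy => mul_nonpos_of_nonneg_of_nonpos hK (hneg _ ?_)
        rw [← height_profileShape, ← shape_eq]
        exact hC x hx y (mem_of_mem_erase hy) (ne_of_mem_erase hy).symm
    _ = #C * ((q : ℝ) ^ (n * r) * F 0) := by rw [sum_const, nsmul_eq_mul]

end Sums

/-- Reversal of the entries of all blocks. It turns left-adjusted sets of coordinates into the sets
of coordinates that the Krawtchouk functions depend on. -/
def blockRev : Vec Q r n ≃ Vec Q r n :=
  Equiv.piCongrRight fun _ => Fin.revPerm.arrowCongr (Equiv.refl Q)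

theorem blockRev_sub [AddGroup Q] (x y : Vec Q r n) :
    blockRev (x - y) = blockRev x - blockRev y := rfl

theorem blockInd_rev_congr [Zero Q] (c : ℝ) {i : ℕ} (hi : i ≤ r) {b b' : Fin r → Q}
    (h : ∀ j : Fin r, (j : ℕ) < i → b j = b' j) :
    blockInd c r i (blockWeight (b ∘ Fin.rev)) = blockInd c r i (blockWeight (b' ∘ Fin.rev)) := by
  rw [blockInd, blockInd]
  refine if_congr ?_ rfl rfl
  rw [← Nat.le_sub_iff_add_le' hi, ← Nat.le_sub_iff_add_le' hi, blockWeight_le_iff,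
    blockWeight_le_iff]
  refine forall₂_congr fun j hj => ?_
  rw [Function.comp_apply, Function.comp_apply, h j.rev (by rw [Fin.val_rev]; omega)]

/-- On reversed blocks, the `i`-th Krawtchouk function depends only on the first `i` entries. -/
theorem blockKraw_rev_congr [Zero Q] (c : ℝ) {i : ℕ} (hi : i ≤ r) {b b' : Fin r → Q}
    (h : ∀ j : Fin r, (j : ℕ) < i → b j = b' j) :
    blockKraw c r i (blockWeight (b ∘ Fin.rev)) = blockKraw c r i (blockWeight (b' ∘ Fin.rev)) := by
  cases i with
  | zero => exact blockInd_rev_congr c hi h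
  | succ i =>
    rw [blockKraw, blockKraw, blockInd_rev_congr c hi h,
      blockInd_rev_congr c (by omega) fun j hj => h j (by omega)]

theorem exists_profile_sum_eq (a : Profile r n) (s : ℕ) (h : ∑ k, (a k : ℕ) + s ≤ n * r) :
    ∃ b : Profile r n, (∀ k, a k ≤ b k) ∧ ∑ k, (b k : ℕ) = ∑ k, (a k : ℕ) + s := by
  induction s with
  | zero => exact ⟨a, fun _ => le_rfl, rfl⟩
  | succ s ih =>
    obtain ⟨b, hab, hb⟩ := ih (by omega)
    have hlt : ∑ k, (b k : ℕ) < ∑ _k : Fin n, r := by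
      rw [sum_const, card_univ, Fintype.card_fin, smul_eq_mul]
      omega
    obtain ⟨k, -, hk⟩ := exists_lt_of_sum_lt hlt
    refine ⟨Function.update b k ⟨b k + 1, by omega⟩, fun l => ?_, ?_⟩
    · rcases eq_or_ne l k with rfl | hl
      · rw [Function.update_self, Fin.le_def]
        exact (hab l).trans (Nat.le_succ _)
      · rw [Function.update_of_ne hl]
        exact hab l
    · rw [← add_sum_erase _ _ (mem_univ k), Function.update_self]
      rw [← add_sum_erase _ _ (mem_univ k)] at hb
      rw [sum_congr rfl fun l hl => by rw [Function.update_of_ne (ne_of_mem_erase hl)]]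
      dsimp only
      omega

/-- The left-adjusted set consisting of the first `b k` coordinates of each block `k`. -/
def prefixSet (b : Profile r n) : Finset (Fin n × Fin r) := {p | (p.2 : ℕ) < b p.1}

theorem leftAdjusted_prefixSet (b : Profile r n) : LeftAdjusted (prefixSet b) := by
  intro k j h j' hj
  rw [prefixSet, mem_filter] at h ⊢
  exact ⟨mem_univ _, (Fin.lt_def.1 hj).trans h.2⟩

theorem card_prefixSet (b : Profile r n) : #(prefixSet b) = ∑ k, (b k : ℕ) := by
  rw [prefixSet, card_filter, Fintype.sum_prod_type]
  refine sum_congr rfl fun k _ => ?_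
  dsimp only
  rw [Fin.sum_univ_eq_sum_range (fun j => if j < (b k : ℕ) then 1 else 0) r, ← card_filter,
    ← card_range (b k : ℕ)]
  congr 1
  ext j
  have := (b k).2
  simp only [mem_filter, mem_range, card_range]
  omega

open Classical in
/-- The sum of a function of the coordinates in `I` over a set of vectors that projects uniformly
to `I` depends only on the multiplicity `m` of the rows. -/
theorem exists_sum_eq_mul [Zero Q] [Fintype Q] {I : Finset (Fin n × Fin r)} {f : Vec Q r n → ℝ}
    (hf : ∀ x y, (∀ p ∈ I, x p.1 p.2 = y p.1 p.2) → f x = f y) :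
    ∃ s : ℝ, ∀ (B : Finset (Vec Q r n)) (m : ℕ),
      (∀ row : I → Q, #{x ∈ B | ∀ p : I, x p.1.1 p.1.2 = row p} = m) →
        ∑ x ∈ B, f x = m * s := by
  refine ⟨∑ row : I → Q, f fun k j => if h : (k, j) ∈ I then row ⟨(k, j), h⟩ else 0,
    fun B m hB => ?_⟩
  rw [← sum_fiberwise B (fun x => fun p : I => x p.1.1 p.1.2), mul_sum]
  refine sum_congr rfl fun row _ => ?_
  rw [← hB row, ← nsmul_eq_mul, ← sum_const]
  refine sum_congr (filter_congr fun x _ => funext_iff) fun x hx => ?_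
  rw [mem_filter] at hx
  refine hf _ _ fun p hp => ?_
  rw [dif_pos hp]
  exact hx.2 ⟨p, hp⟩

/-- A function of the coordinates in a left-adjusted set of size `t` that sums to zero over the
whole space also sums to zero over an ordered orthogonal array of strength `t`. -/
theorem IsOOA.sum_eq_zero [AddCommGroup Q] [Fintype Q] {A : Finset (Vec Q r n)} {t : ℕ}
    (hA : IsOOA A t) {I : Finset (Fin n × Fin r)} (hI : LeftAdjusted I) (hIt : #I = t)
    {f : Vec Q r n → ℝ} (hf : ∀ x y, (∀ p ∈ I, x p.1 p.2 = y p.1 p.2) → f x = f y)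
    (h0 : ∑ x, f x = 0) : ∑ x ∈ A, f x = 0 := by
  classical
  obtain ⟨-, θ, -, hθ⟩ := hA
  obtain ⟨s, hs⟩ := exists_sum_eq_mul hf
  have h1 := hs univ #{x : Vec Q r n | ∀ p : I, x p.1.1 p.1.2 = 0} fun row => by
    refine card_equiv (Equiv.subRight fun k j => if h : (k, j) ∈ I then row ⟨(k, j), h⟩ else 0)
      fun x => ?_
    simp only [mem_filter, mem_univ, true_and, Equiv.subRight_apply, Pi.sub_apply, sub_eq_zero]
    refine forall_congr' fun p => ?_
    rw [dif_pos p.2]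
  have hpos : 0 < #{x : Vec Q r n | ∀ p : I, x p.1.1 p.1.2 = 0} :=
    card_pos.2 ⟨0, by simp⟩
  have hs0 : s = 0 := by
    rw [h0, eq_comm, mul_eq_zero] at h1
    exact h1.resolve_left (by exact_mod_cast hpos.ne')
  rw [hs A θ (hθ I hI hIt), hs0, mul_zero]

theorem IsOOA.nonempty [AddCommGroup Q] {A : Finset (Vec Q r n)} {t : ℕ} (hA : IsOOA A t) :
    A.Nonempty := by
  classical
  obtain ⟨ht, θ, hθ, h⟩ := hA
  obtain ⟨b, -, hb⟩ := exists_profile_sum_eq (0 : Profile r n) t (by simpa using ht)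
  have h1 := h (prefixSet b) (leftAdjusted_prefixSet b) (by rw [card_prefixSet, hb]; simp) 0
  obtain ⟨x, hx⟩ := card_pos.1 (hθ.trans_eq h1.symm)
  exact ⟨x, (mem_filter.1 hx).1⟩

/-- The part of the Fourier transform of an ordered orthogonal array at the low nonzero weights
vanishes. -/
theorem IsOOA.sum_kraw_eq_zero [AddCommGroup Q] [Fintype Q] (hq : Fintype.card Q = q)
    {A : Finset (Vec Q r n)} {t : ℕ} (hA : IsOOA A t) {a : Profile r n} (ha0 : a ≠ 0)
    (hat : ∑ k, (a k : ℕ) ≤ t) (x : Vec Q r n) :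
    ∑ y ∈ A, kraw (q : ℝ) a (profile (blockRev (x - y))) = 0 := by
  obtain ⟨b, hab, hb⟩ := exists_profile_sum_eq a (t - ∑ k, (a k : ℕ)) (by have := hA.1; omega)
  refine hA.sum_eq_zero (leftAdjusted_prefixSet b) (by rw [card_prefixSet, hb]; omega) ?_ ?_
  · intro y z hyz
    refine prod_congr rfl fun k _ => ?_
    refine blockKraw_rev_congr (b := (x - y) k) (b' := (x - z) k) (q : ℝ)
      (Nat.le_of_lt_succ (a k).2) fun j hj => ?_
    rw [Pi.sub_apply, Pi.sub_apply, Pi.sub_apply, Pi.sub_apply, hyz (k, j) ?_]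
    exact mem_filter.2 ⟨mem_univ _, hj.trans_le (hab k)⟩
  · rw [Fintype.sum_equiv blockRev _ (fun y => kraw (q : ℝ) a (profile (blockRev x - y)))
      fun y => by rw [blockRev_sub]]
    obtain ⟨k, hk⟩ := Function.ne_iff.1 ha0
    have h1 := sum_prod_vec (Q := Q) fun (k : Fin n) (b : Fin r → Q) =>
      blockKraw (q : ℝ) r (a k) (blockWeight (blockRev x k - b))
    refine h1.trans (prod_eq_zero (mem_univ k) ?_)
    exact sum_blockKraw_sub hq (Nat.le_of_lt_succ (a k).2) (Fin.val_ne_zero_iff.2 hk) _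

/-- The linear programming bound for ordered orthogonal arrays. -/
theorem transform_le_card_OOA_mul [AddCommGroup Q] [Fintype Q] (hq : Fintype.card Q = q)
    (hq1 : 1 < q) {F : Profile r n → ℝ} (hF : PosDefFun (q : ℝ) F) {t : ℕ}
    (hneg : ∀ w, t < ∑ k, (w k : ℕ) → F w ≤ 0) {A : Finset (Vec Q r n)} (hA : IsOOA A t) :
    transform (q : ℝ) F 0 ≤ #A * F 0 := by
  have hM : (0 : ℝ) < #A := by exact_mod_cast hA.nonempty.card_pos
  have hpsd : ∀ a, 0 ≤ ∑ x ∈ A, ∑ y ∈ A, kraw (q : ℝ) a (profile (blockRev (x - y))) := by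
    intro a
    have h := sum_kraw_profile_sub_nonneg hq (by omega) a (A.map blockRev.toEmbedding)
    simpa only [sum_map, Equiv.coe_toEmbedding, ← blockRev_sub] using h
  refine le_of_mul_le_mul_left ?_ hM
  calc (#A : ℝ) * transform (q : ℝ) F 0
      = ∑ x ∈ A, transform (q : ℝ) F (profile (blockRev (x - x))) := by
        rw [sum_congr rfl fun x _ => by
          rw [sub_self, show blockRev (0 : Vec Q r n) = 0 from rfl, profile_zero], sum_const,
          nsmul_eq_mul]
    _ ≤ ∑ x ∈ A, ∑ y ∈ A, transform (q : ℝ) F (profile (blockRev (x - y))) := by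
        refine sum_le_sum fun x hx => ?_
        exact single_le_sum (f := fun y => transform (q : ℝ) F (profile (blockRev (x - y))))
          (fun y _ => hF _) hx
    _ = ∑ a, F a * ∑ x ∈ A, ∑ y ∈ A, kraw (q : ℝ) a (profile (blockRev (x - y))) := by
        simp only [transform_apply, mul_sum]
        rw [sum_congr rfl fun x _ => sum_comm, sum_comm]
    _ ≤ F 0 * ∑ x ∈ A, ∑ y ∈ A, kraw (q : ℝ) 0 (profile (blockRev (x - y))) := by
        rw [← add_sum_erase _ _ (mem_univ 0), add_le_iff_nonpos_right]
        refine sum_nonpos fun a ha => ?_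
        rcases le_or_gt (∑ k, (a k : ℕ)) t with h | h
        · rw [sum_eq_zero fun x _ => hA.sum_kraw_eq_zero hq (ne_of_mem_erase ha) h x, mul_zero]
        · exact mul_nonpos_of_nonpos_of_nonneg (hneg a h) (hpsd a)
    _ = #A * (#A * F 0) := by
        simp only [kraw_zero_left, sum_const, nsmul_eq_mul, mul_one]
        ring

end Vectors

/-! ### Products and degrees -/

section Degree

variable {q : ℝ} {r n : ℕ}

/-- The functions on profiles of degree at most `κ`: sums of functions each of which depends on at
most `κ` blocks. -/
def lowDegree (q : ℝ) (r n κ : ℕ) : Submodule ℝ (Profile r n → ℝ) where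
  carrier := {u | ∀ a, κ < numNonzero a → transform q u a = 0}
  add_mem' hu hv a ha := by rw [map_add, Pi.add_apply, hu a ha, hv a ha, add_zero]
  zero_mem' a _ := by rw [map_zero, Pi.zero_apply]
  smul_mem' c u hu a ha := by rw [map_smul, Pi.smul_apply, hu a ha, smul_zero]

theorem mem_lowDegree {κ : ℕ} {u : Profile r n → ℝ} :
    u ∈ lowDegree q r n κ ↔ ∀ a, κ < numNonzero a → transform q u a = 0 := Iff.rfl

theorem lowDegree_mono {κ κ' : ℕ} (h : κ ≤ κ') : lowDegree q r n κ ≤ lowDegree q r n κ' :=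
  fun _ hu a ha => hu a (h.trans_lt ha)

theorem sum_blockKraw_eq_zero (hq : 1 < q) {c : ℕ} (hc : c ≤ r) (hc0 : c ≠ 0) :
    ∑ j ∈ range (r + 1), blockKraw q r j c = 0 := by
  rw [← (sum_blockKraw_mul_blockKraw hq (Nat.zero_le r) hc).trans (if_neg hc0.symm)]
  refine sum_congr rfl fun j hj => ?_
  rw [blockKraw_zero_left (by rw [mem_range] at hj; omega), one_mul]

theorem mul_mem_lowDegree (hq : 1 < q) {κ κ' : ℕ} {u v : Profile r n → ℝ}
    (hu : u ∈ lowDegree q r n κ) (hv : v ∈ lowDegree q r n κ') :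
    u * v ∈ lowDegree q r n (κ + κ') := by
  intro c hc
  rw [transform_mul_apply hq]
  refine mul_eq_zero_of_right _ (sum_eq_zero fun a _ => sum_eq_zero fun b _ => ?_)
  by_cases ha : κ < numNonzero a
  · rw [hu a ha, zero_mul, zero_mul]
  by_cases hb : κ' < numNonzero b
  · rw [hv b hb, mul_zero, zero_mul]
  refine mul_eq_zero_of_right _ ?_
  obtain ⟨k, hck, hk⟩ : ∃ k, c k ≠ 0 ∧ a k = 0 ∧ b k = 0 := by
    by_contra! h
    have hsub : univ.filter (fun k => c k ≠ 0) ⊆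
        univ.filter (fun k => a k ≠ 0) ∪ univ.filter (fun k => b k ≠ 0) := by
      intro k hk
      simp only [mem_filter, mem_univ, true_and, mem_union] at hk ⊢
      have := h k hk
      tauto
    have h1 := (card_le_card hsub).trans (card_union_le _ _)
    unfold numNonzero at ha hb hc
    omega
  simp only [kraw, ← prod_mul_distrib]
  rw [sum_prod_profile fun k j =>
    blockKraw q r (a k) j * blockKraw q r (b k) j * blockKraw q r j (c k)]
  refine prod_eq_zero (mem_univ k) ?_
  rw [← sum_blockKraw_eq_zero hq (Nat.le_of_lt_succ (c k).2) (Fin.val_ne_zero_iff.2 hck)]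
  refine sum_congr rfl fun j hj => ?_
  rw [hk.1, hk.2, Fin.val_zero, blockKraw_zero_left (by rw [mem_range] at hj; omega), one_mul,
    one_mul]

theorem one_mem_lowDegree (hq : 1 < q) : (1 : Profile r n → ℝ) ∈ lowDegree q r n 0 := by
  intro c hc
  obtain ⟨k, hk⟩ := card_pos.1 hc
  rw [mem_filter] at hk
  simp only [transform_apply, Pi.one_apply, one_mul, kraw]
  rw [sum_prod_profile fun k j => blockKraw q r j (c k)]
  exact prod_eq_zero (mem_univ k)
    (sum_blockKraw_eq_zero hq (Nat.le_of_lt_succ (c k).2) (Fin.val_ne_zero_iff.2 hk.2))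

theorem apply_mem_lowDegree_one (hq : 1 < q) (g : ℕ → ℝ) (k : Fin n) :
    (fun w : Profile r n => g (w k)) ∈ lowDegree q r n 1 := by
  intro c hc
  obtain ⟨l, hl, hlk⟩ := exists_mem_ne hc k
  rw [mem_filter] at hl
  have h : ∀ w : Profile r n, g (w k) * kraw q w c =
      ∏ l, (if l = k then g (w l) else 1) * blockKraw q r (w l) (c l) := by
    intro w
    rw [prod_mul_distrib, prod_ite_eq' univ k fun l => g (w l), if_pos (mem_univ k), kraw]
  rw [transform_apply, sum_congr rfl fun w _ => h w,
    sum_prod_profile fun l j => (if l = k then g j else 1) * blockKraw q r j (c l)]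
  refine prod_eq_zero (mem_univ l) ?_
  simp only [if_neg hlk, one_mul]
  exact sum_blockKraw_eq_zero hq (Nat.le_of_lt_succ (c l).2) (Fin.val_ne_zero_iff.2 hl.2)

theorem pow_mem_lowDegree (hq : 1 < q) {u : Profile r n → ℝ} (hu : u ∈ lowDegree q r n 1) (m : ℕ) :
    u ^ m ∈ lowDegree q r n m := by
  induction m with
  | zero => exact one_mem_lowDegree hq
  | succ m ih =>
    rw [pow_succ]
    exact mul_mem_lowDegree hq ih hu

theorem prod_mem_lowDegree (hq : 1 < q) {ι : Type*} (s : Finset ι) {u : ι → Profile r n → ℝ}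
    {m : ι → ℕ} (hu : ∀ i ∈ s, u i ∈ lowDegree q r n (m i)) :
    ∏ i ∈ s, u i ∈ lowDegree q r n (∑ i ∈ s, m i) := by
  classical
  induction s using Finset.induction_on with
  | empty => exact one_mem_lowDegree hq
  | insert i s hi ih =>
    rw [prod_insert hi, sum_insert hi]
    exact mul_mem_lowDegree hq (hu i (mem_insert_self i s))
      (ih fun j hj => hu j (mem_insert_of_mem hj))

theorem profileShape_mem_lowDegree (hq : 1 < q) (i : Fin r) :
    (fun w : Profile r n => (profileShape w i : ℝ)) ∈ lowDegree q r n 1 := by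
  have h : (fun w : Profile r n => (profileShape w i : ℝ)) =
      ∑ k, fun w : Profile r n => if (w k : ℕ) = i + 1 then (1 : ℝ) else 0 := by
    funext w
    simp only [profileShape, card_filter, Finset.sum_apply, Fin.ext_iff, Fin.val_succ, Nat.cast_sum,
      Nat.cast_ite, Nat.cast_one, Nat.cast_zero]
  rw [h]
  exact Submodule.sum_mem _ fun k _ =>
    apply_mem_lowDegree_one hq (fun j => if j = i + 1 then (1 : ℝ) else 0) k

end Degree

/-! ### Functions on profiles invariant under permutations of the blocks -/

section Count

variable {r n : ℕ}

theorem profileShape_mem_Delta (w : Profile r n) : profileShape w ∈ Delta r n := by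
  rw [mem_Delta]
  have h := size_profileShape w
  rw [size] at h
  rw [h, numNonzero]
  exact (card_le_univ _).trans_eq (Fintype.card_fin n)

theorem card_fiber_eq (w : Profile r n) (j : Fin (r + 1)) :
    #{k | w k = j} = (Fin.cons (n - size (profileShape w)) (profileShape w) : Fin (r + 1) → ℕ) j := by
  refine Fin.cases ?_ (fun i => rfl) j
  rw [Fin.cons_zero, size_profileShape, numNonzero]
  have h := card_filter_add_card_filter_not (s := (univ : Finset (Fin n))) (fun k => w k = 0)
  rw [card_univ, Fintype.card_fin] at h
  exact (Nat.sub_eq_of_eq_add h.symm).symm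

theorem exists_perm_of_profileShape_eq {w w' : Profile r n}
    (h : profileShape w = profileShape w') : ∃ σ : Equiv.Perm (Fin n), w' ∘ σ = w := by
  have hcard : ∀ j, Fintype.card {k // w k = j} = Fintype.card {k // w' k = j} := by
    intro j
    rw [Fintype.card_subtype, Fintype.card_subtype, card_fiber_eq, card_fiber_eq, h]
  refine ⟨Equiv.ofFiberEquiv (f := w) (g := w') fun j => Fintype.equivOfCardEq (hcard j), ?_⟩
  funext k
  exact Equiv.ofFiberEquiv_map _ k

/-- The number of profiles of a given shape is a multinomial coefficient. -/
theorem card_profileShape_eq {e : Fin r → ℕ} (he : e ∈ Delta r n) :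
    ((n - size e).factorial * ∏ i, (e i).factorial) * #{w : Profile r n | profileShape w = e} =
      n.factorial := by
  have hsize : size e ≤ n := mem_Delta.1 he
  set m : Fin (r + 1) → ℕ := Fin.cons (n - size e) e with hm
  have hmsum : ∑ j, m j = n := by
    rw [Fin.sum_univ_succ, hm]
    simp only [Fin.cons_zero, Fin.cons_succ]
    rw [size] at hsize ⊢
    omega
  have hcount : #{w : Profile r n | profileShape w = e} = Nat.multinomial univ m := by
    set M : Fin (r + 1) →₀ ℕ := Finsupp.equivFunOnFinite.symm m with hM
    have h1 : (∑ j : Fin (r + 1), (MvPolynomial.X j : MvPolynomial (Fin (r + 1)) ℕ)) ^ n =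
        ∑ w : Profile r n, MvPolynomial.monomial (∑ k, Finsupp.single (w k) 1) 1 := by
      rw [← Fin.prod_const n, prod_univ_sum, Fintype.piFinset_univ]
      refine sum_congr rfl fun w _ => ?_
      rw [MvPolynomial.monomial_sum_one]
      rfl
    rw [Finset.sum_pow_eq_sum_piAntidiag] at h1
    have h2 := congrArg (MvPolynomial.coeff M) h1
    rw [MvPolynomial.coeff_sum, MvPolynomial.coeff_sum] at h2
    have h3 : ∀ k : Fin (r + 1) → ℕ, MvPolynomial.coeff M
        ((Nat.multinomial univ k : MvPolynomial (Fin (r + 1)) ℕ) *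
          ∏ i, (MvPolynomial.X i) ^ k i) = if k = m then Nat.multinomial univ k else 0 := by
      intro k
      have h4 : ∏ i, (MvPolynomial.X i : MvPolynomial (Fin (r + 1)) ℕ) ^ k i =
          MvPolynomial.monomial (Finsupp.equivFunOnFinite.symm k) 1 := by
        rw [MvPolynomial.monomial_eq, Finsupp.prod_fintype _ _ fun i => pow_zero _]
        simp
      rw [h4, ← MvPolynomial.C_eq_coe_nat, MvPolynomial.coeff_C_mul, MvPolynomial.coeff_monomial,
        mul_ite, mul_one, mul_zero]
      simp only [hM, EmbeddingLike.apply_eq_iff_eq, Nat.cast_id]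
    rw [sum_congr rfl fun k _ => h3 k, sum_ite_eq', if_pos (by simp [hmsum])] at h2
    rw [h2, card_filter]
    refine sum_congr rfl fun w _ => ?_
    rw [MvPolynomial.coeff_monomial]
    refine if_congr ?_ rfl rfl
    rw [Finsupp.ext_iff]
    have h5 : ∀ j, (∑ k, Finsupp.single (w k) 1 : Fin (r + 1) →₀ ℕ) j = #{k | w k = j} := by
      intro j
      rw [Finsupp.finsetSum_apply, card_filter]
      simp only [Finsupp.single_apply]
    constructor
    · intro h j
      rw [h5, card_fiber_eq, h]
      rfl
    · intro h
      funext i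
      have := h i.succ
      rw [h5] at this
      exact this
  have h := Nat.multinomial_spec univ m
  rw [hmsum, Fin.prod_univ_succ] at h
  rw [hcount]
  exact h

theorem exists_profileShape_eq {e : Fin r → ℕ} (he : e ∈ Delta r n) :
    ∃ w : Profile r n, profileShape w = e := by
  have h := card_profileShape_eq he
  have h1 : 0 < #{w : Profile r n | profileShape w = e} := by
    refine Nat.pos_of_ne_zero fun h0 => ?_
    rw [h0, mul_zero] at h
    exact (Nat.factorial_pos n).ne h
  obtain ⟨w, hw⟩ := card_pos.1 h1
  exact ⟨w, (mem_filter.1 hw).2⟩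

theorem profVal_eq (q : ℝ) (w : Profile r n) :
    profVal q w = (q - 1) ^ size (profileShape w) *
      q ^ (height (profileShape w) - size (profileShape w)) := by
  have h1 : ∀ j : Fin (r + 1), blockVal q j =
      (q - 1) ^ (if j ≠ 0 then 1 else 0) * q ^ ((j : ℕ) - 1) := by
    intro j
    refine Fin.cases ?_ (fun i => ?_) j
    · simp [blockVal]
    · simp [blockVal]
  have h2 : ∑ k, ((w k : ℕ) - 1) + numNonzero w = ∑ k, (w k : ℕ) := by
    rw [numNonzero, card_filter, ← sum_add_distrib]
    refine sum_congr rfl fun k _ => ?_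
    split_ifs with h
    · have := Fin.val_ne_zero_iff.2 h
      omega
    · rw [not_not] at h
      simp [h]
  rw [profVal, prod_congr rfl fun k _ => h1 (w k), prod_mul_distrib, prod_pow_eq_pow_sum,
    prod_pow_eq_pow_sum, size_profileShape, height_profileShape, ← h2, Nat.add_sub_cancel,
    numNonzero, card_filter]

end Count

/-! ### Functions on shapes -/

section FunctionsOnShapes

variable {Q : Type*} {r n : ℕ}

/-- A function on shapes, viewed as a function on profiles. -/
def pull : FunSpace Q r n →ₗ[ℝ] (Profile r n → ℝ) where
  toFun f w := f ⟨profileShape w, profileShape_mem_Delta w⟩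
  map_add' _ _ := rfl
  map_smul' _ _ := rfl

theorem pull_apply (f : FunSpace Q r n) (w : Profile r n) :
    pull f w = f ⟨profileShape w, profileShape_mem_Delta w⟩ := rfl

theorem pull_injective : Function.Injective (pull : FunSpace Q r n →ₗ[ℝ] _) := by
  intro f g h
  funext ⟨e, he⟩
  obtain ⟨w, rfl⟩ := exists_profileShape_eq he
  exact congrFun h w

theorem profileShape_comp_perm (σ : Equiv.Perm (Fin n)) (w : Profile r n) :
    profileShape (w ∘ σ) = profileShape w := by
  funext i
  exact card_equiv σ fun k => by simp

theorem pull_comp_perm (f : FunSpace Q r n) (σ : Equiv.Perm (Fin n)) (w : Profile r n) :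
    pull f (w ∘ σ) = pull f w := by
  simp only [pull_apply, profileShape_comp_perm]

theorem exists_pull_eq {u : Profile r n → ℝ}
    (hu : ∀ (σ : Equiv.Perm (Fin n)) w, u (w ∘ σ) = u w) : ∃ f : FunSpace Q r n, pull f = u := by
  choose w hw using fun e : Delta r n => exists_profileShape_eq e.2
  refine ⟨fun e => u (w e), ?_⟩
  funext v
  obtain ⟨σ, hσ⟩ := exists_perm_of_profileShape_eq
    (hw ⟨profileShape v, profileShape_mem_Delta v⟩)
  rw [← hu σ v, hσ]
  rfl

theorem P_profileShape {q : ℕ} (hr : 1 ≤ r) (w : Profile r n) :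
    P q r n (profileShape w) = profP (q : ℝ) w := by
  have h0 : (r : ℝ) ≠ 0 := by
    have : (1 : ℝ) ≤ r := by exact_mod_cast hr
    linarith
  simp only [P, deltaCrit, profP, blockP, sum_sub_distrib, sum_const, card_univ, Fintype.card_fin,
    nsmul_eq_mul, height_profileShape]
  push_cast
  field_simp

section Coefficients

variable [Fintype Q]

theorem pull_mulP (hr : 1 ≤ r) (f : FunSpace Q r n) :
    pull (mulP Q r n f) = profP (Fintype.card Q : ℝ) * pull f := by
  funext w
  rw [Pi.mul_apply, ← P_profileShape hr]
  rfl

/-- The Krawtchouk coefficients of a function on shapes, indexed by profiles. -/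
def coef : FunSpace Q r n →ₗ[ℝ] (Profile r n → ℝ) :=
  ((Fintype.card Q : ℝ) ^ (n * r))⁻¹ • (transform (Fintype.card Q : ℝ) ∘ₗ pull)

theorem coef_def (f : FunSpace Q r n) (a : Profile r n) :
    coef f a = ((Fintype.card Q : ℝ) ^ (n * r))⁻¹ * transform (Fintype.card Q : ℝ) (pull f) a := rfl

theorem coef_comp_perm (f : FunSpace Q r n) (σ : Equiv.Perm (Fin n)) (a : Profile r n) :
    coef f (a ∘ σ) = coef f a := by
  rw [coef_def, coef_def, transform_comp_perm σ (pull_comp_perm f σ)]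

variable [Nontrivial Q]

theorem one_lt_card_cast : (1 : ℝ) < Fintype.card Q := by
  exact_mod_cast Fintype.one_lt_card

/-- The pullback to profiles turns the inner product of `V` into that of a product measure. -/
theorem inner_eq_sum_pull (f g : FunSpace Q r n) :
    inner ℝ f g = ((Fintype.card Q : ℝ) ^ (n * r))⁻¹ *
      ∑ w, pull f w * pull g w * profVal (Fintype.card Q : ℝ) w := by
  rw [inner_def, mul_sum, ← sum_fiberwise (s := (univ : Finset (Profile r n)))
    (g := fun w => (⟨profileShape w, profileShape_mem_Delta w⟩ : Delta r n))]
  refine sum_congr rfl fun e _ => ?_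
  have h1 : ∀ w ∈ univ.filter (fun w : Profile r n =>
      (⟨profileShape w, profileShape_mem_Delta w⟩ : Delta r n) = e),
      ((Fintype.card Q : ℝ) ^ (n * r))⁻¹ *
        (pull f w * pull g w * profVal (Fintype.card Q : ℝ) w) =
      ((Fintype.card Q : ℝ) ^ (n * r))⁻¹ * (f e * g e *
        (((Fintype.card Q : ℝ) - 1) ^ size (e : Fin r → ℕ) *
          (Fintype.card Q : ℝ) ^ (height (e : Fin r → ℕ) - size (e : Fin r → ℕ)))) := by
    intro w hw
    rw [mem_filter] at hw
    rw [profVal_eq, pull_apply, pull_apply, hw.2, ← hw.2]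
  have h2 : #(univ.filter fun w : Profile r n =>
      (⟨profileShape w, profileShape_mem_Delta w⟩ : Delta r n) = e) =
      #{w : Profile r n | profileShape w = e} := by
    congr 1
    exact filter_congr fun w _ => Subtype.ext_iff
  rw [sum_congr rfl h1, sum_const, nsmul_eq_mul, h2, wt, valency]
  have h3 := card_profileShape_eq e.2
  have h4 : (0 : ℝ) < ((n - size (e : Fin r → ℕ)).factorial : ℝ) *
      ∏ i, (((e : Fin r → ℕ) i).factorial : ℝ) :=
    mul_pos (by exact_mod_cast Nat.factorial_pos _)
      (prod_pos fun i _ => by exact_mod_cast Nat.factorial_pos _)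
  have h5 : (n.factorial : ℝ) / (((n - size (e : Fin r → ℕ)).factorial : ℝ) *
      ∏ i, (((e : Fin r → ℕ) i).factorial : ℝ)) = #{w : Profile r n | profileShape w = e} := by
    rw [div_eq_iff h4.ne', ← h3]
    push_cast
    ring
  rw [h5]
  ring

theorem card_pow_pos : (0 : ℝ) < (Fintype.card Q : ℝ) ^ (n * r) :=
  pow_pos (by linarith [one_lt_card_cast (Q := Q)]) _

theorem transform_coef (f : FunSpace Q r n) : transform (Fintype.card Q : ℝ) (coef f) = pull f := by
  rw [coef, LinearMap.smul_apply, map_smul, LinearMap.comp_apply,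
    transform_transform one_lt_card_cast, smul_smul, inv_mul_cancel₀ card_pow_pos.ne', one_smul]

theorem coef_injective : Function.Injective (coef : FunSpace Q r n →ₗ[ℝ] _) := by
  intro f g h
  apply pull_injective
  rw [← transform_coef, h, transform_coef]

theorem exists_coef_eq {c : Profile r n → ℝ}
    (hc : ∀ (σ : Equiv.Perm (Fin n)) a, c (a ∘ σ) = c a) : ∃ f : FunSpace Q r n, coef f = c := by
  obtain ⟨f, hf⟩ := exists_pull_eq (Q := Q) fun σ w =>
    transform_comp_perm (q := (Fintype.card Q : ℝ)) σ (hc σ) w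
  refine ⟨f, transform_injective (one_lt_card_cast (Q := Q)) ?_⟩
  rw [transform_coef, hf]

theorem inner_eq_sum_coef (f g : FunSpace Q r n) :
    inner ℝ f g = ∑ a, coef f a * coef g a * profVal (Fintype.card Q : ℝ) a := by
  rw [inner_eq_sum_pull, ← transform_coef, ← transform_coef,
    sum_transform_mul_transform one_lt_card_cast, inv_mul_cancel_left₀ card_pow_pos.ne']

end Coefficients

/-! ### Polynomials of bounded degree -/

theorem pull_evalMap (p : MvPolynomial (Fin r) ℝ) :
    pull (evalMap Q r n p) = ∑ d ∈ p.support, MvPolynomial.coeff d p •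
      ∏ i, (fun w : Profile r n => (profileShape w i : ℝ)) ^ d i := by
  funext w
  have h : pull (evalMap Q r n p) w =
      MvPolynomial.aeval (R := ℝ) (fun i => (profileShape w i : ℝ)) p := rfl
  rw [h, MvPolynomial.aeval_def, MvPolynomial.eval₂_eq', Finset.sum_apply]
  refine sum_congr rfl fun d _ => ?_
  simp only [Algebra.algebraMap_self, RingHom.id_apply, Pi.smul_apply, smul_eq_mul,
    Finset.prod_apply, Pi.pow_apply]

/-- The Newton basis polynomial of `m`, up to a constant factor. It vanishes at all shapes `e` such
that `m ≤ e` fails. -/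
def newtonPoly (m : Fin r → ℕ) : MvPolynomial (Fin r) ℝ :=
  ∏ i, ∏ j ∈ range (m i), (MvPolynomial.X i - MvPolynomial.C (j : ℝ))

theorem totalDegree_newtonPoly_le (m : Fin r → ℕ) : (newtonPoly m).totalDegree ≤ ∑ i, m i := by
  refine (MvPolynomial.totalDegree_finsetProd _ _).trans (sum_le_sum fun i _ => ?_)
  have h : ∀ j ∈ range (m i),
      (MvPolynomial.X i - MvPolynomial.C (j : ℝ) : MvPolynomial (Fin r) ℝ).totalDegree ≤ 1 :=
    fun j _ => (MvPolynomial.totalDegree_sub_C_le _ _).trans (MvPolynomial.totalDegree_X i).le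
  refine (MvPolynomial.totalDegree_finsetProd _ _).trans ((sum_le_sum h).trans ?_)
  simp

theorem evalMap_newtonPoly (m : Fin r → ℕ) (e : Delta r n) :
    evalMap Q r n (newtonPoly m) e =
      ∏ i, ∏ j ∈ range (m i), (((e : Fin r → ℕ) i : ℝ) - j) := by
  have h : evalMap Q r n (newtonPoly m) e =
      MvPolynomial.aeval (R := ℝ) (fun i => ((e : Fin r → ℕ) i : ℝ)) (newtonPoly m) := rfl
  rw [h, newtonPoly]
  simp [map_prod]

theorem Delta_mono {κ : ℕ} (hκ : κ ≤ n) : Delta r κ ⊆ Delta r n :=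
  fun _ he => mem_Delta.2 ((mem_Delta.1 he).trans hκ)

theorem linearIndependent_newtonPoly {κ : ℕ} (hκ : κ ≤ n) :
    LinearIndependent ℝ fun m : Delta r κ => evalMap Q r n (newtonPoly m) := by
  rw [Fintype.linearIndependent_iff]
  intro c hc
  by_contra! hne
  obtain ⟨m, hm, hmin⟩ := exists_min_image (univ.filter fun m => c m ≠ 0)
    (fun m : Delta r κ => ∑ i, (m : Fin r → ℕ) i)
    (by obtain ⟨m, hm⟩ := hne; exact ⟨m, mem_filter.2 ⟨mem_univ m, hm⟩⟩)
  rw [mem_filter] at hm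
  set E : Delta r n := ⟨m, Delta_mono hκ m.2⟩ with hE
  have h1 : ∑ m' : Delta r κ, c m' * ∏ i, ∏ j ∈ range ((m' : Fin r → ℕ) i),
      (((m : Fin r → ℕ) i : ℝ) - j) = 0 := by
    refine Eq.trans ?_ (congrFun hc E)
    refine Eq.trans (sum_congr rfl fun m' _ => ?_) (Finset.sum_apply (M := fun _ : Delta r n => ℝ)
      E univ fun m' : Delta r κ => c m' • evalMap Q r n (newtonPoly m')).symm
    exact congrArg (c m' * ·) (evalMap_newtonPoly (Q := Q) (m' : Fin r → ℕ) E).symm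
  -- Of the terms with nonzero coefficient, only the one of `m` itself survives at `m`.
  rw [sum_eq_single m] at h1
  · refine mul_ne_zero hm.2 ?_ h1
    refine prod_ne_zero_iff.2 fun i _ => prod_ne_zero_iff.2 fun j hj => ?_
    rw [mem_range] at hj
    exact sub_ne_zero.2 (by exact_mod_cast hj.ne')
  · intro m' _ hm'
    by_cases hc' : c m' = 0
    · rw [hc', zero_mul]
    · have h3 := hmin m' (mem_filter.2 ⟨mem_univ m', hc'⟩)
      obtain ⟨i, hi⟩ : ∃ i, (m : Fin r → ℕ) i < (m' : Fin r → ℕ) i := by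
        by_contra! hle
        refine hm' (Subtype.ext (funext fun i => ?_))
        exact ((sum_eq_sum_iff_of_le fun i _ => hle i).1
          (le_antisymm (sum_le_sum fun i _ => hle i) h3)) i (mem_univ i)
      exact mul_eq_zero_of_right _
        (prod_eq_zero (mem_univ i) (prod_eq_zero (mem_range.2 hi) (sub_self _)))
  · exact fun h => absurd (mem_univ m) h

variable [Fintype Q] [Nontrivial Q]

theorem pull_mem_lowDegree {κ : ℕ} {f : FunSpace Q r n} (hf : f ∈ polySpace Q r n κ) :
    pull f ∈ lowDegree (Fintype.card Q : ℝ) r n κ := by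
  obtain ⟨p, hp, rfl⟩ := hf
  have hq : (1 : ℝ) < Fintype.card Q := one_lt_card_cast
  rw [SetLike.mem_coe, MvPolynomial.mem_restrictTotalDegree] at hp
  rw [pull_evalMap]
  refine Submodule.sum_mem _ fun d hd => Submodule.smul_mem _ _ ?_
  have h1 := MvPolynomial.le_totalDegree hd
  rw [Finsupp.sum_fintype _ _ fun _ => rfl] at h1
  exact lowDegree_mono (h1.trans hp)
    (prod_mem_lowDegree hq _ fun i _ => pow_mem_lowDegree hq (profileShape_mem_lowDegree hq i) _)

/-- For `κ ≤ n`, the polynomials of degree at most `κ` are exactly the functions whose Krawtchouk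
coefficients of degree more than `κ` vanish. One inclusion follows from the multiplicativity of the
degree, and both spaces have as dimension the number of shapes of size at most `κ`. -/
theorem polySpace_eq {κ : ℕ} (hκ : κ ≤ n) :
    polySpace Q r n κ = (lowDegree (Fintype.card Q : ℝ) r n κ).comap pull := by
  refine Submodule.eq_of_le_of_finrank_le (fun f hf => pull_mem_lowDegree hf) ?_
  trans Fintype.card (Delta r κ)
  · choose w hw using fun e : Delta r κ => exists_profileShape_eq (Delta_mono hκ e.2)
    let ev : (lowDegree (Fintype.card Q : ℝ) r n κ).comap (pull (Q := Q)) →ₗ[ℝ]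
        (Delta r κ → ℝ) :=
      LinearMap.funLeft ℝ ℝ w ∘ₗ coef ∘ₗ Submodule.subtype _
    refine (LinearMap.finrank_le_finrank_of_injective (f := ev) ?_).trans_eq
      (Module.finrank_fintype_fun_eq_card ℝ)
    rw [← LinearMap.ker_eq_bot, LinearMap.ker_eq_bot']
    rintro ⟨f, hf⟩ h0
    refine Subtype.ext (coef_injective ?_)
    funext a
    change coef f a = coef 0 a
    rw [map_zero, Pi.zero_apply]
    by_cases ha : κ < numNonzero a
    · rw [coef_def, hf a ha, mul_zero]
    · have hmem : profileShape a ∈ Delta r κ := by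
        rw [mem_Delta, ← size, size_profileShape]
        omega
      obtain ⟨σ, hσ⟩ := exists_perm_of_profileShape_eq (hw ⟨profileShape a, hmem⟩)
      rw [← coef_comp_perm f σ a, hσ]
      exact congrFun h0 ⟨profileShape a, hmem⟩
  · have h : LinearIndependent ℝ fun m : Delta r κ =>
        (⟨evalMap Q r n (newtonPoly m), Submodule.mem_map_of_mem
          ((MvPolynomial.mem_restrictTotalDegree _ _ _).2
            ((totalDegree_newtonPoly_le _).trans (mem_Delta.1 m.2)))⟩ : polySpace Q r n κ) :=
      LinearIndependent.of_comp (polySpace Q r n κ).subtype (linearIndependent_newtonPoly hκ)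
    exact h.fintype_card_le_finrank

theorem mem_polySpace_iff {κ : ℕ} (hκ : κ ≤ n) {f : FunSpace Q r n} :
    f ∈ polySpace Q r n κ ↔ ∀ a, κ < numNonzero a → coef f a = 0 := by
  rw [polySpace_eq hκ, Submodule.mem_comap, mem_lowDegree]
  refine forall₂_congr fun a _ => ?_
  rw [coef_def, mul_eq_zero, or_iff_right (inv_ne_zero card_pow_pos.ne')]

end FunctionsOnShapes

/-! ### Maximizers of quadratic forms -/

section Form

variable {E : Type*} [NormedAddCommGroup E] [InnerProductSpace ℝ E]

theorem exists_forall_apply_self_le [FiniteDimensional ℝ E] [Nontrivial E] (B : E →ₗ[ℝ] E →ₗ[ℝ] ℝ) :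
    ∃ (μ : ℝ) (x : E), x ≠ 0 ∧ B x x = μ * inner ℝ x x ∧ ∀ y, B y y ≤ μ * inner ℝ y y := by
  have hcont : Continuous fun y => B y y := by
    have : (fun y => B y y) = fun y => B.toContinuousBilinearMap y y := rfl
    rw [this]
    fun_prop
  obtain ⟨x, hx, hmax⟩ := (isCompact_sphere (0 : E) 1).exists_isMaxOn
    (NormedSpace.sphere_nonempty.2 zero_le_one) hcont.continuousOn
  rw [mem_sphere_zero_iff_norm] at hx
  refine ⟨B x x, x, fun h => by simp [h] at hx, ?_, fun y => ?_⟩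
  · rw [real_inner_self_eq_norm_sq, hx]
    ring
  · rcases eq_or_ne y 0 with rfl | hy
    · simp
    · have hn : 0 < ‖y‖ := norm_pos_iff.2 hy
      have h1 : B (‖y‖⁻¹ • y) (‖y‖⁻¹ • y) ≤ B x x :=
        hmax (by rw [mem_sphere_zero_iff_norm, norm_smul, norm_inv, norm_norm,
          inv_mul_cancel₀ hn.ne'])
      simp only [map_smul, LinearMap.smul_apply, smul_eq_mul] at h1
      rw [real_inner_self_eq_norm_sq]
      have h2 : B y y = ‖y‖ ^ 2 * (‖y‖⁻¹ * (‖y‖⁻¹ * B y y)) := by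
        field_simp
      rw [h2, mul_comm]
      exact mul_le_mul_of_nonneg_right h1 (sq_nonneg _)

/-- The first-order condition at a maximizer of the Rayleigh quotient. -/
theorem apply_eq_of_forall_apply_self_le {B : E →ₗ[ℝ] E →ₗ[ℝ] ℝ} (hB : ∀ x y, B x y = B y x)
    {μ : ℝ} (hle : ∀ y, B y y ≤ μ * inner ℝ y y) {x : E} (hx : B x x = μ * inner ℝ x x) (y : E) :
    B x y = μ * inner ℝ x y := by
  let D : LinearMap.BilinForm ℝ E := μ • innerₗ E - B
  have hD : ∀ u v, D u v = μ * inner ℝ u v - B u v := fun u v => rfl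
  have h := LinearMap.BilinForm.apply_sq_le_of_symm D
    (fun u => by rw [hD]; exact sub_nonneg.2 (hle u))
    ⟨fun u v => by rw [hD, hD, hB, real_inner_comm]; rfl⟩ x y
  rw [hD x x, hx, sub_self, zero_mul, hD] at h
  have := pow_eq_zero_iff (two_ne_zero) |>.1 (le_antisymm h (sq_nonneg _))
  linarith

end Form

/-! ### The perturbed operator and its positive eigenvector -/

section Eigenvector

/-- Taking absolute values of the Krawtchouk coefficients does not decrease the quadratic form of a
positive definite function. -/
theorem sum_mul_transform_le_abs {q : ℝ} {r n : ℕ} (hq : 2 ≤ q) {p : Profile r n → ℝ}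
    (hp : PosDefFun q p) (c : Profile r n → ℝ) :
    ∑ w, p w * transform q c w * transform q c w * profVal q w ≤
      ∑ w, p w * transform q (fun a => |c a|) w * transform q (fun a => |c a|) w *
        profVal q w := by
  have hkraw : ∀ a : Profile r n, PosDefFun q (kraw q a) := by
    intro a b
    rw [transform_apply, sum_kraw_mul_kraw (by linarith)]
    positivity
  have hexp : ∀ c : Profile r n → ℝ,
      ∑ w, p w * transform q c w * transform q c w * profVal q w =
        ∑ a, ∑ b, c a * c b * transform q (p * kraw q a * kraw q b) 0 := by
    intro c
    simp only [transform_zero_apply, mul_sum]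
    rw [sum_congr rfl fun a _ => sum_comm, sum_comm]
    refine sum_congr rfl fun w _ => ?_
    rw [mul_assoc (p w), transform_apply, sum_mul_sum, mul_sum, sum_mul]
    refine sum_congr rfl fun a _ => ?_
    rw [mul_sum, sum_mul]
    refine sum_congr rfl fun b _ => ?_
    simp only [Pi.mul_apply]
    ring
  rw [hexp, hexp]
  refine sum_le_sum fun a _ => sum_le_sum fun b _ => ?_
  rw [← abs_mul]
  exact mul_le_mul_of_nonneg_right (le_abs_self _) (((hp.mul hq (hkraw a)).mul hq (hkraw b)) 0)

variable {Q : Type*} {r n : ℕ} [Fintype Q] [Nontrivial Q]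

theorem two_le_card_cast : (2 : ℝ) ≤ Fintype.card Q := by
  exact_mod_cast Fintype.one_lt_card

variable (Q r n) in
/-- The bilinear form on `V` whose restriction to `V_κ` is that of the operator `S_κ - θ Π_κ`, where
`Π_κ` is the projection on the terms of degree `κ`. -/
def perturbedForm (κ : ℕ) (θ : ℝ) : FunSpace Q r n →ₗ[ℝ] FunSpace Q r n →ₗ[ℝ] ℝ :=
  LinearMap.mk₂ ℝ
    (fun f g => inner ℝ (mulP Q r n f) g -
      θ * ∑ a with numNonzero a = κ, coef f a * coef g a * profVal (Fintype.card Q : ℝ) a)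
    (fun f f' g => by
      simp only [map_add, inner_add_left, Pi.add_apply, add_mul, sum_add_distrib]
      ring)
    (fun c f g => by
      simp only [map_smul, inner_smul_left, Pi.smul_apply, smul_eq_mul, mul_assoc, ← mul_sum,
        conj_trivial]
      ring)
    (fun f g g' => by
      simp only [map_add, inner_add_right, Pi.add_apply, mul_add, add_mul, sum_add_distrib]
      ring)
    (fun c f g => by
      simp only [map_smul, inner_smul_right, Pi.smul_apply, smul_eq_mul, mul_left_comm _ c,
        mul_assoc, ← mul_sum]
      ring)

theorem perturbedForm_apply (κ : ℕ) (θ : ℝ) (f g : FunSpace Q r n) :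
    perturbedForm Q r n κ θ f g = inner ℝ (mulP Q r n f) g -
      θ * ∑ a with numNonzero a = κ, coef f a * coef g a * profVal (Fintype.card Q : ℝ) a := rfl

theorem inner_mulP_comm (f g : FunSpace Q r n) :
    inner ℝ (mulP Q r n f) g = inner ℝ (mulP Q r n g) f := by
  rw [inner_def, inner_def]
  refine Finset.sum_congr rfl fun e _ => ?_
  change P _ r n e * f e * g e * _ = P _ r n e * g e * f e * _
  ring

theorem perturbedForm_comm (κ : ℕ) (θ : ℝ) (f g : FunSpace Q r n) :
    perturbedForm Q r n κ θ f g = perturbedForm Q r n κ θ g f := by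
  rw [perturbedForm_apply, perturbedForm_apply, inner_mulP_comm]
  simp only [mul_comm (coef f _)]

/-- A maximizer of the Rayleigh quotient of a perturbed form on `V_κ`. -/
theorem exists_perturbedForm_max (κ : ℕ) (θ : ℝ) :
    ∃ (μ : ℝ) (f : FunSpace Q r n), f ∈ polySpace Q r n κ ∧ f ≠ 0 ∧
      perturbedForm Q r n κ θ f f = μ * inner ℝ f f ∧
      ∀ g ∈ polySpace Q r n κ, perturbedForm Q r n κ θ g g ≤ μ * inner ℝ g g := by
  obtain ⟨μ, x, hx0, hx, hmax⟩ := exists_forall_apply_self_le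
    ((perturbedForm Q r n κ θ).domRestrict₁₂ (polySpace Q r n κ) (polySpace Q r n κ))
  exact ⟨μ, x, x.2, fun h => hx0 (Subtype.ext h), hx, fun g hg => hmax ⟨g, hg⟩⟩

theorem perturbedForm_eq_of_max {κ : ℕ} {θ μ : ℝ}
    (hmax : ∀ g ∈ polySpace Q r n κ, perturbedForm Q r n κ θ g g ≤ μ * inner ℝ g g)
    {f g : FunSpace Q r n} (hf : f ∈ polySpace Q r n κ) (hg : g ∈ polySpace Q r n κ)
    (h : perturbedForm Q r n κ θ f f = μ * inner ℝ f f) :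
    perturbedForm Q r n κ θ f g = μ * inner ℝ f g :=
  apply_eq_of_forall_apply_self_le
    (B := (perturbedForm Q r n κ θ).domRestrict₁₂ (polySpace Q r n κ) (polySpace Q r n κ))
    (fun x y => perturbedForm_comm κ θ (x : FunSpace Q r n) y) (fun y => hmax y y.2)
    (x := ⟨f, hf⟩) h ⟨g, hg⟩

theorem inner_S (κ : ℕ) (f g : polySpace Q r n κ) :
    inner ℝ (S Q r n κ f) g = inner ℝ (mulP Q r n f) (g : FunSpace Q r n) :=
  Submodule.inner_orthogonalProjectionOnto_eq_of_mem_right g _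

theorem inner_mulP_le (κ : ℕ) {f : FunSpace Q r n} (hf : f ∈ polySpace Q r n κ) :
    inner ℝ (mulP Q r n f) f ≤ topEigenvalue Q r n κ * inner ℝ f f := by
  obtain ⟨μ, x, hx, hx0, hxx, hmax⟩ := exists_perturbedForm_max (Q := Q) (r := r) (n := n) κ 0
  have h0 : ∀ f g : FunSpace Q r n,
      perturbedForm Q r n κ 0 f g = inner ℝ (mulP Q r n f) g := by
    intro f g
    rw [perturbedForm_apply, zero_mul, sub_zero]
  have heig : Module.End.HasEigenvalue (S Q r n κ) μ := by
    refine Module.End.hasEigenvalue_of_hasEigenvector (x := ⟨x, hx⟩)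
      (Module.End.hasEigenvector_iff.2 ⟨Module.End.mem_eigenspace_iff.2 ?_,
        fun h => hx0 (congrArg Subtype.val h)⟩)
    refine ext_inner_right ℝ fun y => ?_
    rw [inner_S, ← h0, perturbedForm_eq_of_max hmax hx y.2 hxx, real_inner_smul_left]
    rfl
  rw [← h0]
  exact (hmax f hf).trans (mul_le_mul_of_nonneg_right
    ((topEigenvalue_isGreatest Q r n κ).2 heig) real_inner_self_nonneg)

theorem exists_inner_mulP_eq (κ : ℕ) : ∃ f ∈ polySpace Q r n κ, f ≠ 0 ∧
    inner ℝ (mulP Q r n f) f = topEigenvalue Q r n κ * inner ℝ f f := by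
  obtain ⟨x, hx⟩ := (topEigenvalue_isGreatest Q r n κ).1.exists_hasEigenvector
  refine ⟨x, x.2, fun h => hx.2 (Subtype.ext h), ?_⟩
  rw [← inner_S, hx.apply_eq_smul, real_inner_smul_left]
  rfl

/-- The maximum of the Rayleigh quotient of a perturbed form is attained at a function with
nonnegative Krawtchouk coefficients, which then satisfies the eigenvalue equation. -/
theorem exists_nonneg_eigenvector (hr : 1 ≤ r) {κ : ℕ} (hκ : κ ≤ n) (θ : ℝ) :
    ∃ (μ : ℝ) (f : FunSpace Q r n), f ∈ polySpace Q r n κ ∧ f ≠ 0 ∧ (∀ a, 0 ≤ coef f a) ∧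
      perturbedForm Q r n κ θ f f = μ * inner ℝ f f ∧
      (∀ g ∈ polySpace Q r n κ, perturbedForm Q r n κ θ g g ≤ μ * inner ℝ g g) ∧
      ∀ a, numNonzero a ≤ κ →
        coef (mulP Q r n f) a = (μ + if numNonzero a = κ then θ else 0) * coef f a := by
  obtain ⟨μ, x, hx, hx0, hxx, hmax⟩ := exists_perturbedForm_max (Q := Q) (r := r) (n := n) κ θ
  obtain ⟨f, hf⟩ := exists_coef_eq (Q := Q) (r := r) (n := n) (c := fun a => |coef x a|)
    fun σ a => by rw [coef_comp_perm]
  have hfκ : f ∈ polySpace Q r n κ := by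
    rw [mem_polySpace_iff hκ] at hx ⊢
    intro a ha
    simp only [hf, hx a ha, abs_zero]
  have hinner : inner ℝ f f = inner ℝ x x := by
    rw [inner_eq_sum_coef, inner_eq_sum_coef, hf]
    simp only [abs_mul_abs_self]
  have hf0 : f ≠ 0 := by
    rw [← inner_self_ne_zero (𝕜 := ℝ), hinner]
    exact inner_self_ne_zero.2 hx0
  have hle : perturbedForm Q r n κ θ x x ≤ perturbedForm Q r n κ θ f f := by
    rw [perturbedForm_apply, perturbedForm_apply, hf]
    simp only [abs_mul_abs_self]
    refine sub_le_sub_right ?_ _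
    rw [inner_eq_sum_pull, inner_eq_sum_pull, pull_mulP hr, pull_mulP hr, ← transform_coef,
      ← transform_coef, hf]
    refine mul_le_mul_of_nonneg_left ?_ (inv_nonneg.2 card_pow_pos.le)
    exact sum_mul_transform_le_abs two_le_card_cast (posDefFun_profP one_lt_card_cast) (coef x)
  have hff : perturbedForm Q r n κ θ f f = μ * inner ℝ f f :=
    le_antisymm (hmax f hfκ) (by rw [hinner, ← hxx]; exact hle)
  refine ⟨μ, f, hfκ, hf0, fun a => by rw [hf]; exact abs_nonneg _, hff, hmax, ?_⟩
  -- The defect `y` of the eigenvalue equation, truncated to degree `κ`, is orthogonal to itself.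
  set y : Profile r n → ℝ := fun a => if numNonzero a ≤ κ then
    coef (mulP Q r n f) a - (μ + if numNonzero a = κ then θ else 0) * coef f a else 0 with hy
  obtain ⟨u, hu⟩ := exists_coef_eq (Q := Q) (r := r) (n := n) (c := y) fun σ a => by
    rw [hy]
    simp only [numNonzero_comp_perm, coef_comp_perm]
  have huκ : u ∈ polySpace Q r n κ := by
    rw [mem_polySpace_iff hκ]
    intro a ha
    rw [hu, hy]
    exact if_neg (not_le.2 ha)
  have h1 := perturbedForm_eq_of_max hmax hfκ huκ hff
  rw [perturbedForm_apply, inner_eq_sum_coef, inner_eq_sum_coef, sum_filter, mul_sum, mul_sum,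
    ← sub_eq_zero, ← sum_sub_distrib, ← sum_sub_distrib, hu] at h1
  have h2 : ∑ a, y a * y a * profVal (Fintype.card Q : ℝ) a = 0 := by
    rw [← h1]
    refine sum_congr rfl fun a _ => ?_
    by_cases ha : numNonzero a ≤ κ
    · have hya : y a = coef (mulP Q r n f) a -
          (μ + if numNonzero a = κ then θ else 0) * coef f a := if_pos ha
      split_ifs at hya ⊢ <;> linear_combination (y a * profVal (Fintype.card Q : ℝ) a) * hya
    · have hya : y a = 0 := if_neg ha
      rw [hya]
      simp
  intro a ha
  have hv := profVal_pos (one_lt_card_cast (Q := Q)) a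
  have h3 := (sum_eq_zero_iff_of_nonneg fun a _ => mul_nonneg (mul_self_nonneg (y a))
    (profVal_pos (one_lt_card_cast (Q := Q)) a).le).1 h2 a (mem_univ a)
  have h4 : y a = 0 := mul_self_eq_zero.1 ((mul_eq_zero.1 h3).resolve_right hv.ne')
  rw [hy] at h4
  simp only [if_pos ha] at h4
  linarith

/-- The maximum eigenvalue is less than the maximum of `P`: a function at which the latter is
attained is supported at the zero shape, and has Krawtchouk coefficients of all degrees. -/
theorem topEigenvalue_lt (hr : 1 ≤ r) {κ : ℕ} (hκ : κ < n) :
    topEigenvalue Q r n κ < profP (Fintype.card Q : ℝ) (0 : Profile r n) := by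
  by_contra! hle
  obtain ⟨f, hf, hf0, heq⟩ := exists_inner_mulP_eq (Q := Q) (r := r) (n := n) κ
  have hK := card_pow_pos (Q := Q) (r := r) (n := n)
  have hP : ∀ w : Profile r n, profP (Fintype.card Q : ℝ) (0 : Profile r n) -
      profP (Fintype.card Q : ℝ) w = ∑ k, ((w k : ℕ) : ℝ) := by
    intro w
    rw [profP, profP, ← sum_sub_distrib]
    refine sum_congr rfl fun k _ => ?_
    simp [blockP]
  have h1 : ∑ w, (∑ k, ((w k : ℕ) : ℝ)) *
      (pull f w * pull f w * profVal (Fintype.card Q : ℝ) w) ≤ 0 := by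
    have h2 := mul_le_mul_of_nonneg_right hle (real_inner_self_nonneg (x := f))
    rw [← heq, inner_eq_sum_pull, inner_eq_sum_pull, pull_mulP hr, mul_left_comm,
      mul_le_mul_iff_right₀ (inv_pos.2 hK), mul_sum, ← sub_nonpos, ← sum_sub_distrib] at h2
    refine le_of_eq_of_le (sum_congr rfl fun w _ => ?_) h2
    rw [← hP, Pi.mul_apply]
    ring
  have h3 : ∀ w : Profile r n, 0 ≤ (∑ k, ((w k : ℕ) : ℝ)) *
      (pull f w * pull f w * profVal (Fintype.card Q : ℝ) w) := fun w =>
    mul_nonneg (sum_nonneg fun _ _ => Nat.cast_nonneg _)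
      (mul_nonneg (mul_self_nonneg _) (profVal_pos (one_lt_card_cast (Q := Q)) w).le)
  have h4 : ∀ w : Profile r n, w ≠ 0 → pull f w = 0 := by
    intro w hw
    have h5 := (sum_eq_zero_iff_of_nonneg fun w _ => h3 w).1
      (le_antisymm h1 (sum_nonneg fun w _ => h3 w)) w (mem_univ w)
    obtain ⟨k, hk⟩ := Function.ne_iff.1 hw
    have h6 : (0 : ℝ) < ∑ k, ((w k : ℕ) : ℝ) :=
      sum_pos' (fun _ _ => Nat.cast_nonneg _)
        ⟨k, mem_univ k, Nat.cast_pos.2 (Nat.pos_of_ne_zero (Fin.val_ne_zero_iff.2 hk))⟩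
    exact mul_self_eq_zero.1 ((mul_eq_zero.1 ((mul_eq_zero.1 h5).resolve_left h6.ne')).resolve_right
      (profVal_pos (one_lt_card_cast (Q := Q)) w).ne')
  have hlast : numNonzero (fun _ => Fin.last r : Profile r n) = n := by
    have : Fin.last r ≠ 0 := Fin.val_ne_zero_iff.1 (by rw [Fin.val_last]; omega)
    simp [numNonzero, this]
  have h7 := (mem_polySpace_iff hκ.le).1 hf (fun _ => Fin.last r) (by omega)
  rw [coef_def, mul_eq_zero, or_iff_right (inv_ne_zero hK.ne'), transform_apply, sum_eq_single 0,
    kraw_zero_left, mul_one] at h7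
  · refine hf0 (pull_injective (funext fun w => ?_))
    rw [map_zero, Pi.zero_apply]
    by_cases hw : w = 0
    · rw [hw, h7]
    · exact h4 w hw
  · intro w _ hw
    rw [h4 w hw, zero_mul]
  · exact fun h => absurd (mem_univ 0) h

/-! ### The bounds -/

/-- The function on profiles to which the linear programming bounds are applied. -/
theorem exists_certificate (hr : 1 ≤ r) {κ d : ℕ} (hκ : 1 ≤ κ) (hκn : κ < n)
    (hP : ∀ e ∈ Delta r n, d ≤ height e →
      P (Fintype.card Q) r n e ≤ topEigenvalue Q r n (κ - 1)) :
    ∃ F : Profile r n → ℝ, PosDefFun (Fintype.card Q : ℝ) F ∧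
      (∀ w, d ≤ ∑ k, (w k : ℕ) → F w ≤ 0) ∧ 0 < transform (Fintype.card Q : ℝ) F 0 ∧
      (Fintype.card Q : ℝ) ^ (n * r) * F 0 *
          (profP (Fintype.card Q : ℝ) (0 : Profile r n) - topEigenvalue Q r n κ) ≤
        4 * ((n - κ) * blockP (Fintype.card Q : ℝ) r 0) *
          ((n.choose κ : ℝ) * ((Fintype.card Q : ℝ) ^ r - 1) ^ κ) *
          transform (Fintype.card Q : ℝ) F 0 := by
  have hq1 : (1 : ℝ) < Fintype.card Q := one_lt_card_cast
  have hq2 : (2 : ℝ) ≤ Fintype.card Q := two_le_card_cast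
  have hK := card_pow_pos (Q := Q) (r := r) (n := n)
  set q : ℝ := (Fintype.card Q : ℝ) with hq
  set D := profP q (0 : Profile r n) with hD
  -- This value of `θ` minimizes the resulting bound `(θ + (n - κ) r δ)² / θ`.
  set θ : ℝ := (n - κ) * blockP q r 0 with hθ
  have hθ0 : 0 < θ := by
    have : (κ : ℝ) < n := by exact_mod_cast hκn
    exact mul_pos (by linarith) (blockP_zero_pos hq2 hr)
  obtain ⟨μ, f, hf, hf0, hpos, hff, hmax, heig⟩ :=
    exists_nonneg_eigenvector (Q := Q) hr hκn.le θ
  have hinner : 0 < inner ℝ f f := real_inner_self_pos.2 hf0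
  have hv : ∀ a : Profile r n, 0 ≤ profVal q a := fun a => (profVal_pos hq1 a).le
  have hμκ : μ ≤ topEigenvalue Q r n κ := by
    refine le_of_mul_le_mul_right ?_ hinner
    refine le_trans ?_ (inner_mulP_le κ hf)
    rw [← hff, perturbedForm_apply, sub_le_self_iff]
    exact mul_nonneg hθ0.le (sum_nonneg fun a _ => mul_nonneg (mul_self_nonneg _) (hv a))
  have hμD : μ < D := hμκ.trans_lt (topEigenvalue_lt hr hκn)
  have hμ' : topEigenvalue Q r n (κ - 1) ≤ μ := by
    obtain ⟨g, hg, hg0, heq⟩ := exists_inner_mulP_eq (Q := Q) (r := r) (n := n) (κ - 1)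
    rw [mem_polySpace_iff (by omega)] at hg
    refine le_of_mul_le_mul_right ?_ (real_inner_self_pos.2 hg0)
    rw [← heq]
    refine le_trans (le_of_eq ?_)
      (hmax g ((mem_polySpace_iff hκn.le).2 fun a ha => hg a (by omega)))
    rw [perturbedForm_apply, sum_eq_zero, mul_zero, sub_zero]
    intro a ha
    rw [hg a (by rw [mem_filter] at ha; omega), zero_mul, zero_mul]
  set c := coef f with hc
  have hcert := certificate hq2 (κ := κ) hpos ((mem_polySpace_iff hκn.le).1 hf) (μ := μ) hθ0.le (by
    intro a ha
    rw [← heig a ha, transform_coef, coef_def, pull_mulP hr, mul_inv_cancel_left₀ hK.ne'])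
  set g := transform q c with hg
  set F : Profile r n → ℝ := (profP q - fun _ => μ) * g * g with hF
  obtain ⟨hFpos, hF0, hg0⟩ := hcert
  set S2 := ∑ a with numNonzero a = κ, c a * c a * profVal q a with hS2
  set G := ∑ a with numNonzero a = κ, c a * profVal q a with hG
  set N := ∑ a : Profile r n with numNonzero a = κ, profVal q a with hN
  have hg0pos : 0 < g 0 := by
    rw [hg, transform_zero_apply]
    obtain ⟨a, ha⟩ : ∃ a, c a ≠ 0 := by
      by_contra! h
      exact hf0 (coef_injective (by rw [map_zero]; exact funext h))
    exact sum_pos' (fun a _ => mul_nonneg (hpos a) (hv a))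
      ⟨a, mem_univ a, mul_pos ((hpos a).lt_of_ne ha.symm) (profVal_pos hq1 a)⟩
  have hGpos : 0 < G := by
    have h1 : 0 < (D - μ) * g 0 := mul_pos (by linarith) hg0pos
    rw [hg0] at h1
    exact (mul_pos_iff_of_pos_left (by linarith)).1 h1
  have hCS : G ^ 2 ≤ N * S2 := by
    refine sum_sq_le_sum_mul_sum_of_sq_le_mul _ (fun a _ => hv a)
      (fun a _ => mul_nonneg (mul_self_nonneg _) (hv a)) fun a _ => le_of_eq (by ring)
  have hN0 : 0 ≤ N := sum_nonneg fun a _ => hv a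
  have hS2pos : 0 < S2 := by
    by_contra! h
    nlinarith [mul_nonneg hN0 (neg_nonneg.2 h), pow_pos hGpos 2]
  refine ⟨F, hFpos, fun w hw => ?_, ?_, ?_⟩
  · have h1 := hP (profileShape w) (profileShape_mem_Delta w) (by rwa [height_profileShape])
    rw [P_profileShape hr] at h1
    have h2 : F w = (profP q w - μ) * (g w * g w) := mul_assoc _ _ _
    rw [h2]
    exact mul_nonpos_of_nonpos_of_nonneg (by linarith) (mul_self_nonneg _)
  · rw [hF0]
    positivity
  · have h2 : F 0 = (D - μ) * g 0 * g 0 := rfl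
    have h3 : 0 ≤ F 0 := by
      rw [h2]
      exact (mul_pos (mul_pos (by linarith) hg0pos) hg0pos).le
    rw [← sum_profVal_of_numNonzero_eq, ← hN, hF0]
    calc q ^ (n * r) * F 0 * (D - topEigenvalue Q r n κ)
        ≤ q ^ (n * r) * F 0 * (D - μ) :=
          mul_le_mul_of_nonneg_left (by linarith) (mul_nonneg hK.le h3)
      _ = q ^ (n * r) * ((D - μ) * g 0) ^ 2 := by rw [h2]; ring
      _ = q ^ (n * r) * (4 * θ ^ 2) * G ^ 2 := by rw [hg0]; ring
      _ ≤ q ^ (n * r) * (4 * θ ^ 2) * (N * S2) := mul_le_mul_of_nonneg_left hCS (by positivity)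
      _ = 4 * θ * N * (q ^ (n * r) * (θ * S2)) := by ring

end Eigenvector

end OrderedHamming

end

theorem theorem5p2 (Q : Type*) [AddCommGroup Q] [Fintype Q] [Nontrivial Q]
    (q r n κ d : ℕ) (hq : Fintype.card Q = q) (hr : 1 ≤ r) (hd : 1 ≤ d)
    (hκ : 1 ≤ κ) (hκn : κ < n)
    (hP : ∀ e ∈ OrderedHamming.Delta r n, d ≤ OrderedHamming.height e →
      OrderedHamming.P q r n e ≤ OrderedHamming.topEigenvalue Q r n (κ - 1)) :
    (∀ C : Finset (OrderedHamming.Vec Q r n), OrderedHamming.IsOrderedCode C d →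
      (C.card : ℝ) ≤
        4 * r * OrderedHamming.deltaCrit q r * ((n : ℝ) - κ) * ((q : ℝ) ^ r - 1) ^ κ
          / (OrderedHamming.deltaCrit q r * r * n - OrderedHamming.topEigenvalue Q r n κ)
          * (n.choose κ : ℝ)) ∧
    (∀ A : Finset (OrderedHamming.Vec Q r n), OrderedHamming.IsOOA A (d - 1) →
      (q : ℝ) ^ (n * r) / (n.choose κ : ℝ)
          * ((OrderedHamming.deltaCrit q r * r * n - OrderedHamming.topEigenvalue Q r n κ)
            / (4 * r * OrderedHamming.deltaCrit q r * ((n : ℝ) - κ) * ((q : ℝ) ^ r - 1) ^ κ))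
        ≤ (A.card : ℝ)) := by
  subst hq
  have hq1 : 1 < Fintype.card Q := Fintype.one_lt_card
  have hδ : OrderedHamming.deltaCrit (Fintype.card Q) r * r =
      OrderedHamming.blockP (Fintype.card Q : ℝ) r 0 := by
    have h0 : (r : ℝ) ≠ 0 := by
      have : (1 : ℝ) ≤ r := by exact_mod_cast hr
      linarith
    rw [OrderedHamming.deltaCrit, OrderedHamming.blockP]
    field_simp
    simp
  have hD : OrderedHamming.deltaCrit (Fintype.card Q) r * r * n =
      OrderedHamming.profP (Fintype.card Q : ℝ) (0 : OrderedHamming.Profile r n) := by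
    rw [hδ, OrderedHamming.profP]
    simp [mul_comm]
  have hlt := OrderedHamming.topEigenvalue_lt (Q := Q) hr hκn
  obtain ⟨F, hF, hneg, hF0, hbound⟩ := OrderedHamming.exists_certificate hr hκ hκn hP
  rw [← hD] at hlt hbound
  have hb : 4 * (r : ℝ) * OrderedHamming.deltaCrit (Fintype.card Q) r * ((n : ℝ) - κ) =
      4 * (((n : ℝ) - κ) * OrderedHamming.blockP (Fintype.card Q : ℝ) r 0) := by
    rw [← hδ]
    ring
  rw [hb]
  have hgap := sub_pos.2 hlt
  have hchoose : (0 : ℝ) < n.choose κ := by exact_mod_cast Nat.choose_pos hκn.le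
  have hpow : (0 : ℝ) < ((Fintype.card Q : ℝ) ^ r - 1) ^ κ := by
    have : (1 : ℝ) < (Fintype.card Q : ℝ) ^ r := one_lt_pow₀ (by exact_mod_cast hq1) (by omega)
    exact pow_pos (by linarith) _
  have hθ : 0 < 4 * (((n : ℝ) - κ) * OrderedHamming.blockP (Fintype.card Q : ℝ) r 0) := by
    have h1 : (κ : ℝ) < n := by exact_mod_cast hκn
    have h2 := OrderedHamming.blockP_zero_pos (q := (Fintype.card Q : ℝ))
      (by exact_mod_cast hq1) hr
    exact mul_pos four_pos (mul_pos (by linarith) h2)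
  constructor
  · intro C hC
    rw [div_mul_eq_mul_div, le_div_iff₀ hgap]
    refine le_of_mul_le_mul_right ?_ hF0
    have h1 := mul_le_mul_of_nonneg_right
      (OrderedHamming.card_code_mul_le rfl hq1 hF hneg hC) hgap.le
    linarith
  · intro A hA
    rw [div_mul_div_comm, div_le_iff₀ (by positivity)]
    refine le_of_mul_le_mul_right ?_ hF0
    have h1 := OrderedHamming.transform_le_card_OOA_mul rfl hq1 hF
      (fun w hw => hneg w (by omega)) hA
    have h2 : (0 : ℝ) ≤ (Fintype.card Q : ℝ) ^ (n * r) := by positivity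
    have h3 := mul_le_mul_of_nonneg_left h1 (mul_nonneg h2 hgap.le)
    have h4 := mul_le_mul_of_nonneg_left hbound (Nat.cast_nonneg (α := ℝ) #A)
    linarith
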